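/- Let $k$ be an algebraically closed field and let $d\ge 1$ be an integer such that $\operatorname{char}(k)$ does not divide $d+1$. Let $f\in R=k[x,y,z]$ be a nonzero homogeneous polynomial of degree $d+1$ that is reduced (that is, the ideal $(f)$ is radical), and assume that the plane curve $X=V(f)\subset\mathbb P^2_k$ is singular. Write $f_x,f_y,f_z$ for the partial derivatives of $f$, let $$\mathrm{Syz}(J_f)=\{(g_0,g_1,g_2)\in R^3 : g_0f_x+g_1f_y+g_2f_z=0\},$$ and let $e=\mathrm{indeg}(\mathrm{Syz}(J_f))$ be the least integer $n$ for which there is a nonzero element $(g_0,g_1,g_2)$ of $\mathrm{Syz}(J_f)$ with all $g_i$ homogeneous of degree $n$. For a singular point $p$ of $X$, choose an affine chart $\mathbb A^2_k\subset\mathbb P^2_k$ containing $p$, with coordinate ring $A=k[T,U]$; let $F\in A$ be the dehomogenization of $f$ and $\mathfrak p\subset A$ the maximal ideal of $p$. The Tjurina number of $X$ at $p$ is $\tau_p(X)=\dim_k A_{\mathfrak p}/(F,F_T,F_U)A_{\mathfrak p}$, and the total Tjurina number is $\tau(X)=\sum_{p\in\mathrm{Sing}(X)}\tau_p(X)$.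 Then $X$ has finitely many singular points, every $\tau_p(X)$ is finite, and $$d(d-e)\ \le\ \tau(X)\ \le\ d^2+e(e-d).$$ -/

import Mathlib

open MvPolynomial LinearAlgebra.Projectivization

namespace PlaneCurve

noncomputable section

variable {k : Type*} [Field k]

/-- The module `Syz(J_f)` of first syzygies of the partial derivatives of `f ∈ k[x, y, z]`: the
kernel of the map `R³ → R`, `(g₀, g₁, g₂) ↦ g₀ f_x + g₁ f_y + g₂ f_z`. -/
def syz (f : MvPolynomial (Fin 3) k) :
    Submodule (MvPolynomial (Fin 3) k) (Fin 3 → MvPolynomial (Fin 3) k) :=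
  LinearMap.ker (Fintype.linearCombination (MvPolynomial (Fin 3) k) fun i => pderiv i f)

/-- `indeg(M) = min {n | M_n ≠ 0}` for a graded submodule `M` of `R³`, `R = k[x, y, z]`, where
`R³` carries the standard grading: `(g₀, g₁, g₂)` has degree `n` if every `gᵢ` is a form of
degree `n`. -/
def indeg (M : Submodule (MvPolynomial (Fin 3) k) (Fin 3 → MvPolynomial (Fin 3) k)) : ℕ :=
  sInf {n | ∃ g ∈ M, g ≠ 0 ∧ ∀ i, (g i).IsHomogeneous n}

theorem mem_syz {f : MvPolynomial (Fin 3) k} {g : Fin 3 → MvPolynomial (Fin 3) k} :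
    g ∈ syz f ↔ g 0 * pderiv 0 f + g 1 * pderiv 1 f + g 2 * pderiv 2 f = 0 := by
  simp [syz, Fintype.linearCombination_apply, Fin.sum_univ_three]

/-- The minimum that defines `indeg(Syz(J_f))` is over a nonempty set, and so is attained. -/
theorem isLeast_indeg_syz {f : MvPolynomial (Fin 3) k} {m : ℕ} (hf : f.IsHomogeneous m) :
    IsLeast {n | ∃ g ∈ syz f, g ≠ 0 ∧ ∀ i, (g i).IsHomogeneous n} (indeg (syz f)) := by
  have hne : {n | ∃ g ∈ syz f, g ≠ 0 ∧ ∀ i, (g i).IsHomogeneous n}.Nonempty := by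
    by_cases h : pderiv 0 f = 0
    · refine ⟨0, ![1, 0, 0], ?_, ?_, ?_⟩
      · simp [mem_syz, h]
      · intro h0
        simpa using congrFun h0 0
      · intro i
        fin_cases i
        · exact isHomogeneous_one _ _
        · exact isHomogeneous_zero _ _ _
        · exact isHomogeneous_zero _ _ _
    · refine ⟨m - 1, ![- pderiv 1 f, pderiv 0 f, 0], ?_, ?_, ?_⟩
      · rw [mem_syz]
        simp
        ring
      · intro h0
        exact h (by simpa using congrFun h0 1)
      · intro i
        fin_cases i
        · exact hf.pderiv.neg
        · exact hf.pderiv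
        · exact isHomogeneous_zero _ _ _
  exact ⟨Nat.sInf_mem hne, fun n hn => Nat.sInf_le hn⟩

/-- The singular points of the projective plane curve `X = V(f) ⊆ ℙ²`, for a form `f`. -/
def singularPoints (f : MvPolynomial (Fin 3) k) : Set (ℙ k (Fin 3 → k)) :=
  {p | eval p.rep f = 0 ∧ ∀ i, eval p.rep (pderiv i f) = 0}

/-- The maximal ideal of the point `a` of the affine plane, in the coordinate ring `k[T, U]`. -/
abbrev pointIdeal (a : Fin 2 → k) : Ideal (MvPolynomial (Fin 2) k) :=
  RingHom.ker (eval a)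

instance pointIdeal_isPrime (a : Fin 2 → k) : (pointIdeal a).IsPrime :=
  RingHom.ker_isPrime (eval a)

/-- The full Jacobian ideal `(F, F_T, F_U)` of `F ∈ k[T, U]`. -/
def fullJacobianIdeal (F : MvPolynomial (Fin 2) k) : Ideal (MvPolynomial (Fin 2) k) :=
  Ideal.span {F, pderiv 0 F, pderiv 1 F}

/-- The Tjurina local algebra `A_𝔭 / (F, F_T, F_U)_𝔭` of `F ∈ A = k[T, U]` at the point `a` of the
affine plane, whose maximal ideal is `𝔭`. -/
abbrev TjurinaAlgebra (F : MvPolynomial (Fin 2) k) (a : Fin 2 → k) : Type _ :=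
  Localization.AtPrime (pointIdeal a) ⧸
    (fullJacobianIdeal F).map
      (algebraMap (MvPolynomial (Fin 2) k) (Localization.AtPrime (pointIdeal a)))

theorem exists_rep_ne_zero (p : ℙ k (Fin 3 → k)) : ∃ i, p.rep i ≠ 0 :=
  Function.ne_iff.mp p.rep_nonzero

/-- An index `i` such that `p` lies in the standard affine chart `x_i ≠ 0` of `ℙ²`. -/
def chart (p : ℙ k (Fin 3 → k)) : Fin 3 :=
  (exists_rep_ne_zero p).choose

/-- The equation of `V(f)` in the chart `x_i ≠ 0`: put `x_i = 1` and name the other two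
coordinates, in their order, `T` and `U`. -/
def dehomogenize (i : Fin 3) (f : MvPolynomial (Fin 3) k) : MvPolynomial (Fin 2) k :=
  aeval (i.insertNth (1 : MvPolynomial (Fin 2) k) X) f

/-- The affine coordinates of `p` in the chart chosen for it. -/
def affineCoords (p : ℙ k (Fin 3 → k)) : Fin 2 → k :=
  fun j => p.rep ((chart p).succAbove j) / p.rep (chart p)

/-- The Tjurina local algebra of the curve `V(f) ⊆ ℙ²` at the point `p`. -/
abbrev LocalTjurinaAlgebra (f : MvPolynomial (Fin 3) k) (p : ℙ k (Fin 3 → k)) : Type _ :=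
  TjurinaAlgebra (dehomogenize (chart p) f) (affineCoords p)

/-- The Tjurina number `τ_p(X)` of `X = V(f)` at `p`. -/
def localTjurina (f : MvPolynomial (Fin 3) k) (p : ℙ k (Fin 3 → k)) : ℕ :=
  Module.finrank k (LocalTjurinaAlgebra f p)

/-- The total Tjurina number `τ(X)` of `X = V(f)`: the sum of the Tjurina numbers at all singular
points. -/
def totalTjurina (f : MvPolynomial (Fin 3) k) : ℕ :=
  ∑ᶠ p ∈ singularPoints f, localTjurina f p

end

end PlaneCurve

/-!
Write `R = k[x, y, z]`, let `J` be the ideal generated by the three partial derivatives `f_x, f_y,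
f_z` (forms of degree `d`), and let `g` be a nonzero syzygy of minimal degree `e`. The proof compares
the total Tjurina number with the Hilbert function of `R/J`.

*Coprimality.* Since `f` is squarefree and `d + 1` is invertible in `k`, the partial derivatives have
no common prime divisor (`noCommonPrime_pderiv`); in positive characteristic this uses that a
polynomial with vanishing derivatives over a perfect field is a `p`-th power. By minimality of the
degree, the entries of `g` have no common prime divisor either (`noCommonPrime_of_minimal_syz`).

*Bounds for the Hilbert function.* Rank-nullity for `h ↦ h₀ f_x + h₁ f_y + h₂ f_z` on triples of
forms reduces the computation of `dim (R/J)_n` to that of the dimension of the graded pieces of the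
syzygy module `Syz`. The map `h ↦ g × h` on `Syz` has kernel `R g`, and as `g × h` is orthogonal to
`g` and `h`, so parallel to the gradient `∇f`, its image is `I ∇f` for an ideal `I` of `R`. The
identity `g × (∇f × b) = (g · b) ∇f` shows that `I` contains the entries of `g`, hence a complete
intersection of two forms of degree `e`. So the codimension of `I` in `R` is, in every large degree,
between `0` and `e²`, and counting dimensions gives
`d (d - e) ≤ dim (R/J)_n ≤ d² + e (e - d)` for all large `n` (`hilbertFn_bounds`).

*Comparison with the Tjurina number.* A bounded Hilbert function forces the set of zeros of `J` in
the projective plane, which is the set of singular points, to be finite (`projZeros_finite`). Choose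
a linear form `l` that vanishes at none of them. The Nullstellensatz shows that multiplication by `l`
is bijective on `R/J` in large degrees, so that `dim (R/J)_n` is eventually the dimension of the
finite algebra `R/(J + (l - 1))` (`finrank_quotient_eq_hilbertFn`). This algebra is the product of
its localizations, one for each singular point (`exists_equiv_primeSpectrum`), and the rescalings
`x ↦ x / l` and `x ↦ x / xᵢ` identify the localization at a point with the local Tjurina algebra in
a chart `xᵢ = 1` containing it (`nonempty_algEquiv_of_isLocalRingAt`). Hence `dim (R/J)_n` is the
total Tjurina number for large `n` (`totalTjurina_eq_hilbertFn`).
-/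

namespace PlaneCurve

universe u

section Polynomials

variable {k : Type*} [Field k]

/-! ### Graded pieces of the polynomial ring -/

section Graded

attribute [local instance] MvPolynomial.gradedAlgebra

variable {σ : Type*}

theorem coe_decompose_eq_homogeneousComponent (q : MvPolynomial σ k) (m : ℕ) :
    (DirectSum.decompose (homogeneousSubmodule σ k) q m : MvPolynomial σ k) =
      homogeneousComponent m q :=
  decomposition.decompose'_apply q m

theorem homogeneousComponent_add_mul {g : MvPolynomial σ k} {e : ℕ} (hg : g.IsHomogeneous e)
    (n : ℕ) (c : MvPolynomial σ k) :
    homogeneousComponent (n + e) (c * g) = homogeneousComponent n c * g := by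
  have h := DirectSum.coe_decompose_mul_add_of_right_mem (homogeneousSubmodule σ k) (i := n)
    (a := c) (b := g) hg
  rwa [coe_decompose_eq_homogeneousComponent, coe_decompose_eq_homogeneousComponent] at h

theorem homogeneousComponent_mul_of_lt {g : MvPolynomial σ k} {e n : ℕ} (hg : g.IsHomogeneous e)
    (h : n < e) (c : MvPolynomial σ k) : homogeneousComponent n (c * g) = 0 := by
  have h := DirectSum.coe_decompose_mul_of_right_mem_of_not_le (homogeneousSubmodule σ k) (n := n)
    (a := c) (b := g) hg (not_le.2 h)
  rwa [coe_decompose_eq_homogeneousComponent] at h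

end Graded

/-- Rank-nullity for the restriction of a linear map to a finite-dimensional subspace. -/
theorem finrank_map_add_finrank_inf_ker {V W : Type*} [AddCommGroup V] [Module k V]
    [AddCommGroup W] [Module k W] (L : V →ₗ[k] W) (U : Submodule k V) [FiniteDimensional k U] :
    Module.finrank k (U.map L) + Module.finrank k (U ⊓ LinearMap.ker L : Submodule k V) =
      Module.finrank k U := by
  rw [← LinearMap.finrank_range_add_finrank_ker (L.domRestrict U), LinearMap.range_domRestrict,
    LinearMap.ker_domRestrict, ← Submodule.finrank_map_subtype_eq,
    Submodule.map_comap_subtype]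

section Dimension

instance (n : ℕ) : FiniteDimensional k (homogeneousSubmodule (Fin 3) k n) :=
  Module.Finite.iff_fg.2 (homogeneousSubmodule_fg (Fin 3) k n)

/-- The forms of degree `n` in three variables have dimension `(n + 1)(n + 2) / 2`. -/
theorem two_mul_finrank_homogeneousSubmodule (n : ℕ) :
    2 * Module.finrank k (homogeneousSubmodule (Fin 3) k n) = (n + 1) * (n + 2) := by
  have h1 : Module.finrank k (homogeneousSubmodule (Fin 3) k n) =
      (Finset.finsuppAntidiag (Finset.univ : Finset (Fin 3)) n).card := by
    have hset : {d : Fin 3 →₀ ℕ | d.degree = n} =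
        ((Finset.finsuppAntidiag (Finset.univ : Finset (Fin 3)) n : Finset _) : Set _) := by
      ext d
      simp [Finset.mem_finsuppAntidiag, Finsupp.degree_eq_sum]
    rw [homogeneousSubmodule_eq_finsupp_supported, hset,
      (AddMonoidAlgebra.supportedEquivFinsupp _).finrank_eq, Module.finrank_finsupp_self]
    simp
  rw [h1, Finset.card_finsuppAntidiag_nat_eq_choose]
  have h2 : (3 + n - 1).choose n = (n + 2).choose 2 := by
    rw [show 3 + n - 1 = n + 2 by omega]
    exact Nat.choose_symm_add
  simp only [Finset.card_univ, Fintype.card_fin]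
  rw [h2, Nat.choose_two_right, Nat.mul_div_cancel' (Nat.even_mul_pred_self (n + 2)).two_dvd]
  simp [mul_comm]

end Dimension

/-! ### Families without a common prime divisor -/

/-- The members of the family have no common prime divisor. -/
def NoCommonPrime {ι A : Type*} [CommRing A] (w : ι → A) : Prop :=
  ∀ q, Prime q → ∃ i, ¬ q ∣ w i

/-- The consequence `gcd (wⱼ b) = b` of `gcd (wⱼ) = 1`, in terms of divisors. -/
theorem NoCommonPrime.dvd_of_forall_dvd_mul {ι A : Type*} [CommRing A] [IsDomain A]
    [UniqueFactorizationMonoid A] {w : ι → A} (hw : NoCommonPrime w) (hw0 : ∃ i, w i ≠ 0)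
    (a : A) : ∀ b, (∀ j, a ∣ w j * b) → a ∣ b := by
  induction a using UniqueFactorizationMonoid.induction_on_prime with
  | h₁ =>
    intro b hb
    obtain ⟨i, hi⟩ := hw0
    have := hb i
    rw [zero_dvd_iff, mul_eq_zero] at this
    simp [this.resolve_left hi]
  | h₂ u hu => exact fun b _ => hu.dvd
  | h₃ a p ha hp ih =>
    intro b hb
    obtain ⟨j, hj⟩ := hw p hp
    obtain ⟨c, rfl⟩ := (hp.dvd_or_dvd ((dvd_mul_right p a).trans (hb j))).resolve_left hj
    refine mul_dvd_mul_left p (ih c fun i => ?_)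
    have := hb i
    rwa [mul_left_comm, mul_dvd_mul_iff_left hp.ne_zero] at this

/-- A vector `h` parallel to a vector `w` with coprime entries is a multiple of `w`. -/
theorem NoCommonPrime.exists_eq_mul {ι A : Type*} [CommRing A] [IsDomain A]
    [UniqueFactorizationMonoid A] {w h : ι → A} (hw : NoCommonPrime w) (hw0 : ∃ i, w i ≠ 0)
    (hwh : ∀ i j, w i * h j = w j * h i) : ∃ c, ∀ i, h i = c * w i := by
  obtain ⟨i, hi⟩ := hw0
  obtain ⟨c, hc⟩ := hw.dvd_of_forall_dvd_mul ⟨i, hi⟩ (w i) (h i)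
    fun j => ⟨h j, (hwh i j).symm⟩
  refine ⟨c, fun j => mul_left_cancel₀ hi ?_⟩
  rw [hwh i j, hc]
  ring

/-- Over an infinite field, two suitable linear combinations of three elements without a common
prime divisor are themselves without one: each of the finitely many prime divisors of `w i` rules
out at most one scalar. -/
theorem NoCommonPrime.exists_not_dvd_add_smul {A : Type*} [CommRing A] [IsDomain A] [Algebra k A]
    [Infinite k] [UniqueFactorizationMonoid A] {w : Fin 3 → A} (hw : NoCommonPrime w) {i : Fin 3}
    (hi : w i ≠ 0) : ∃ c : k, ∀ q, Prime q → q ∣ w i → ¬ q ∣ w (i + 1) + c • w (i + 2) := by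
  classical
  by_contra! hcon
  have hfac : ∀ c : k, ∃ p : (UniqueFactorizationMonoid.factors (w i)).toFinset,
      (p : A) ∣ w (i + 1) + c • w (i + 2) := by
    intro c
    obtain ⟨q, hq, hqi, hqc⟩ := hcon c
    obtain ⟨p, hp, hpq⟩ := UniqueFactorizationMonoid.exists_mem_factors_of_dvd hi hq.irreducible hqi
    exact ⟨⟨p, Multiset.mem_toFinset.2 hp⟩, hpq.symm.dvd.trans hqc⟩
  choose p hp using hfac
  obtain ⟨c, c', hcc, hpc⟩ := Finite.exists_ne_map_eq_of_infinite p
  have hmem := Multiset.mem_toFinset.1 (p c).2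
  have h2 : (p c : A) ∣ w (i + 2) := by
    have h := dvd_sub (hp c) (hpc ▸ hp c')
    rw [add_sub_add_left_eq_sub, ← sub_smul] at h
    have h' := (h.mul_left (algebraMap k A (c - c')⁻¹))
    rwa [← Algebra.smul_def, smul_smul, inv_mul_cancel₀ (sub_ne_zero.2 hcc), one_smul] at h'
  have h1 : (p c : A) ∣ w (i + 1) := by
    have h := dvd_sub (hp c) (h2.mul_left (algebraMap k A c))
    rwa [← Algebra.smul_def, add_sub_cancel_right] at h
  have h0 : (p c : A) ∣ w i := UniqueFactorizationMonoid.dvd_of_mem_factors hmem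
  obtain ⟨j, hj⟩ := hw _ (UniqueFactorizationMonoid.prime_of_factor _ hmem)
  fin_cases i <;> fin_cases j <;> simp_all

/-! ### Polynomials with vanishing partial derivatives -/

/-- A polynomial over a perfect field all of whose partial derivatives vanish is a constant or,
in characteristic `p`, a `p`-th power; in neither case is it prime. -/
theorem not_prime_of_forall_pderiv_eq_zero {σ : Type*} [PerfectField k] {q : MvPolynomial σ k}
    (h : ∀ i, pderiv i q = 0) : ¬ Prime q := by
  classical
  intro hq
  obtain ⟨p, hp⟩ := ExpChar.exists k
  have hdvd : ∀ m ∈ q.support, ∀ i, ((m i : ℕ) : k) = 0 := by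
    intro m hm i
    by_contra hne
    have h0 : m i ≠ 0 := fun h0 => hne (by simp [h0])
    have hc := congrArg (coeff (m - Finsupp.single i 1)) (h i)
    have hle : Finsupp.single i 1 ≤ m := by
      simpa [Finsupp.single_le_iff] using Nat.one_le_iff_ne_zero.2 h0
    rw [coeff_pderiv, tsub_add_cancel_of_le hle, coeff_zero] at hc
    have hmi : (((m - Finsupp.single i 1 : σ →₀ ℕ) i : ℕ) : k) + 1 = (m i : k) := by
      rw [← Nat.cast_add_one]
      congr 1
      simp
      omega
    rw [hmi] at hc
    rcases mul_eq_zero.1 hc with hc | hc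
    · exact mem_support_iff.1 hm hc
    · exact hne hc
  rcases hp with _ | ⟨hp'⟩
  · have hC : q = C (coeff 0 q) := by
      ext m
      by_cases hm : m ∈ q.support
      · have : m = 0 := by
          ext i
          simpa using hdvd m hm i
        simp [this]
      · have h0 := notMem_support_iff.1 hm
        rw [coeff_C]
        split_ifs with hm0
        · rw [hm0]
        · exact h0
    rw [hC] at hq
    have hne : coeff 0 q ≠ 0 := fun h0 => hq.ne_zero (by simp [h0])
    exact hq.not_isUnit ((isUnit_iff_ne_zero.2 hne).map C)
  · have : Fact p.Prime := ⟨hp'⟩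
    have : ExpChar k p := .prime hp'
    have : PerfectRing k p := PerfectField.toPerfectRing p
    -- Exponents and coefficients both have `p`-th roots, so every monomial of `q` is a `p`-th power.
    have hr : ∀ m ∈ q.support, ∃ r : MvPolynomial σ k, r ^ p = monomial m (coeff m q) := by
      intro m hm
      have hm' : p • m.mapRange (· / p) (Nat.zero_div p) = m := by
        refine Finsupp.ext fun i => ?_
        have : p ∣ m i := (CharP.cast_eq_zero_iff k p _).1 (hdvd m hm i)
        simpa using Nat.mul_div_cancel' this
      refine ⟨monomial (m.mapRange (· / p) (Nat.zero_div p))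
        ((frobeniusEquiv k p).symm (coeff m q)), ?_⟩
      rw [monomial_pow, hm', frobeniusEquiv_symm_pow_p]
    choose! r hr using hr
    have hpow : q = (∑ m ∈ q.support, r m) ^ p := by
      rw [sum_pow_char p]
      conv_lhs => rw [q.as_sum]
      exact Finset.sum_congr rfl fun m hm => (hr m hm).symm
    rw [hpow] at hq
    exact not_irreducible_pow hp'.ne_one hq.irreducible

/-! ### The partial derivatives and a minimal syzygy have coprime entries -/

theorem exists_mem_support_degree_eq_totalDegree {σ : Type*} {q : MvPolynomial σ k} (hq : q ≠ 0) :
    ∃ m ∈ q.support, m.degree = q.totalDegree := by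
  obtain ⟨m, hm, h⟩ := q.support.exists_mem_eq_sup (support_nonempty.2 hq)
    fun s => s.sum fun _ e => e
  exact ⟨m, hm, h.symm⟩

theorem homogeneousComponent_totalDegree_ne_zero {σ : Type*} {q : MvPolynomial σ k} (hq : q ≠ 0) :
    homogeneousComponent q.totalDegree q ≠ 0 := by
  obtain ⟨m, hm, h⟩ := exists_mem_support_degree_eq_totalDegree hq
  intro h0
  have := congrArg (coeff m) h0
  rw [coeff_homogeneousComponent, if_pos h, coeff_zero] at this
  exact mem_support_iff.1 hm this

theorem totalDegree_pderiv_lt {σ : Type*} {q : MvPolynomial σ k} {i : σ} (hq : pderiv i q ≠ 0) :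
    (pderiv i q).totalDegree < q.totalDegree := by
  obtain ⟨m, hm, h⟩ := exists_mem_support_degree_eq_totalDegree hq
  have hc : m + Finsupp.single i 1 ∈ q.support := by
    rw [mem_support_iff, coeff_pderiv] at hm
    exact mem_support_iff.2 (left_ne_zero_of_mul hm)
  have h1 : (m + Finsupp.single i 1).degree ≤ q.totalDegree := le_totalDegree hc
  rw [map_add, Finsupp.degree_single] at h1
  omega

theorem homogeneousComponent_mem_syz {f : MvPolynomial (Fin 3) k} {d : ℕ}
    (hf : f.IsHomogeneous (d + 1)) {h : Fin 3 → MvPolynomial (Fin 3) k} (hh : h ∈ syz f) (n : ℕ) :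
    (fun i => homogeneousComponent n (h i)) ∈ syz f := by
  rw [mem_syz] at hh ⊢
  have hd : ∀ i, (pderiv i f).IsHomogeneous d := fun i => hf.pderiv
  have := congrArg (homogeneousComponent (n + d)) hh
  simpa [homogeneousComponent_add_mul (hd _)] using this

/-- A nonzero homogeneous syzygy of minimal degree has coprime entries: after division by a common
factor, the top degree part of a nonzero entry would extend to a syzygy of smaller degree. -/
theorem noCommonPrime_of_minimal_syz {f : MvPolynomial (Fin 3) k} {d : ℕ}
    (hf : f.IsHomogeneous (d + 1)) {g : Fin 3 → MvPolynomial (Fin 3) k} (hg : g ∈ syz f)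
    (hg0 : g ≠ 0) (hgh : ∀ i, (g i).IsHomogeneous (indeg (syz f))) : NoCommonPrime g := by
  intro q hq
  by_contra! hcon
  choose h hh using hcon
  obtain ⟨i, hi⟩ := Function.ne_iff.1 hg0
  have hhi : h i ≠ 0 := fun h0 => hi (by rw [hh i, h0, mul_zero]; rfl)
  have hsyz : h ∈ syz f := by
    rw [mem_syz] at hg ⊢
    refine mul_left_cancel₀ hq.ne_zero ?_
    rw [hh 0, hh 1, hh 2] at hg
    linear_combination hg
  have hle : indeg (syz f) ≤ (h i).totalDegree := by
    refine (isLeast_indeg_syz hf).2 ⟨_, homogeneousComponent_mem_syz hf hsyz _, ?_,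
      fun j => homogeneousComponent_isHomogeneous _ _⟩
    intro h0
    exact homogeneousComponent_totalDegree_ne_zero hhi (congrFun h0 i)
  have hdeg : (g i).totalDegree = indeg (syz f) := (hgh i).totalDegree hi
  rw [hh i, totalDegree_mul_of_isDomain hq.ne_zero hhi] at hdeg
  have hq0 : q.totalDegree = 0 := by omega
  rw [totalDegree_eq_zero_iff_eq_C] at hq0
  rw [hq0] at hq
  have hne : coeff 0 q ≠ 0 := fun h0 => hq.ne_zero (by simp [h0])
  exact hq.not_isUnit ((isUnit_iff_ne_zero.2 hne).map C)

/-- The partial derivatives of a squarefree form of degree prime to the characteristic have no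
common prime divisor: by Euler's identity such a divisor `q` divides the form, once, so it divides
its own derivatives, which therefore vanish. -/
theorem noCommonPrime_pderiv [PerfectField k] {f : MvPolynomial (Fin 3) k} {d : ℕ}
    (hd : ((d + 1 : ℕ) : k) ≠ 0) (hf : f.IsHomogeneous (d + 1)) (hsq : Squarefree f) :
    NoCommonPrime fun i => pderiv i f := by
  intro q hq
  by_contra! hcon
  have hqf : q ∣ f := by
    have h := hf.sum_X_mul_pderiv
    have h1 : q ∣ (d + 1) • f := h ▸ Finset.dvd_sum fun i _ => (hcon i).mul_left _
    have h2 := h1.mul_left (C ((d + 1 : ℕ) : k)⁻¹)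
    rwa [← Nat.cast_smul_eq_nsmul k, smul_eq_C_mul, ← mul_assoc, ← C_mul, inv_mul_cancel₀ hd,
      C_1, one_mul] at h2
  obtain ⟨h, rfl⟩ := hqf
  have hqh : ¬ q ∣ h := fun hqh => hq.not_isUnit (hsq q (mul_dvd_mul_left q hqh))
  refine not_prime_of_forall_pderiv_eq_zero (fun i => ?_) hq
  have h1 := hcon i
  rw [pderiv_mul, dvd_add_left (dvd_mul_right _ _)] at h1
  have h2 := (hq.dvd_or_dvd h1).resolve_right hqh
  by_contra hne
  exact (totalDegree_le_of_dvd_of_isDomain h2 hne).not_gt (totalDegree_pderiv_lt hne)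

/-! ### The Hilbert function of an ideal generated by three forms with a syzygy -/

/-- The triples of forms of degree `n`. -/
noncomputable def formTriples (k : Type*) [Field k] (n : ℕ) : Submodule k (Fin 3 → MvPolynomial (Fin 3) k) :=
  Submodule.pi Set.univ fun _ => homogeneousSubmodule (Fin 3) k n

theorem mem_formTriples {n : ℕ} {h : Fin 3 → MvPolynomial (Fin 3) k} :
    h ∈ formTriples k n ↔ ∀ i, (h i).IsHomogeneous n := by
  simp [formTriples, Submodule.mem_pi]

/-- Triples of forms, as functions into the space of forms. -/
noncomputable def formTriplesEquiv (k : Type*) [Field k] (n : ℕ) :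
    formTriples k n ≃ₗ[k] (Fin 3 → homogeneousSubmodule (Fin 3) k n) where
  toFun h i := ⟨h.1 i, mem_formTriples.1 h.2 i⟩
  invFun h := ⟨fun i => (h i).1, mem_formTriples.2 fun i => (h i).2⟩
  map_add' _ _ := rfl
  map_smul' _ _ := rfl

instance (n : ℕ) : FiniteDimensional k (formTriples k n) :=
  Module.Finite.equiv (formTriplesEquiv k n).symm

theorem finrank_formTriples (n : ℕ) : Module.finrank k (formTriples k n) =
    3 * Module.finrank k (homogeneousSubmodule (Fin 3) k n) := by
  rw [(formTriplesEquiv k n).finrank_eq, Module.finrank_pi_fintype]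
  simp

/-- The map `h ↦ ∑ hᵢ wᵢ`, as a `k`-linear map. -/
noncomputable def dotMap (w : Fin 3 → MvPolynomial (Fin 3) k) :
    (Fin 3 → MvPolynomial (Fin 3) k) →ₗ[k] MvPolynomial (Fin 3) k :=
  (Fintype.linearCombination (MvPolynomial (Fin 3) k) w).restrictScalars k

theorem dotMap_apply (w h : Fin 3 → MvPolynomial (Fin 3) k) :
    dotMap w h = h 0 * w 0 + h 1 * w 1 + h 2 * w 2 := by
  simp [dotMap, Fintype.linearCombination_apply, Fin.sum_univ_three]

/-- The map `h ↦ g × h`, as a `k`-linear map. -/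
noncomputable def crossMap (g : Fin 3 → MvPolynomial (Fin 3) k) :
    (Fin 3 → MvPolynomial (Fin 3) k) →ₗ[k] (Fin 3 → MvPolynomial (Fin 3) k) :=
  (crossProduct g).restrictScalars k

theorem crossMap_apply (g h : Fin 3 → MvPolynomial (Fin 3) k) : crossMap g h =
    ![g 1 * h 2 - g 2 * h 1, g 2 * h 0 - g 0 * h 2, g 0 * h 1 - g 1 * h 0] :=
  cross_apply g h

/-- The map `c ↦ c w`, as a `k`-linear map. -/
noncomputable def smulMap (w : Fin 3 → MvPolynomial (Fin 3) k) :
    MvPolynomial (Fin 3) k →ₗ[k] (Fin 3 → MvPolynomial (Fin 3) k) :=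
  (LinearMap.toSpanSingleton (MvPolynomial (Fin 3) k) _ w).restrictScalars k

theorem smulMap_apply (w : Fin 3 → MvPolynomial (Fin 3) k) (c : MvPolynomial (Fin 3) k) (i : Fin 3) :
    smulMap w c i = c * w i := rfl

theorem smulMap_injective {w : Fin 3 → MvPolynomial (Fin 3) k} {i : Fin 3} (hw : w i ≠ 0) :
    Function.Injective (smulMap w) := fun _ _ hab =>
  mul_right_cancel₀ hw (congrFun hab i)

theorem finrank_map_smulMap {w : Fin 3 → MvPolynomial (Fin 3) k} {i : Fin 3} (hw : w i ≠ 0)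
    (U : Submodule k (MvPolynomial (Fin 3) k)) :
    Module.finrank k (U.map (smulMap w)) = Module.finrank k U :=
  (Submodule.equivMapOfInjective _ (smulMap_injective hw) U).finrank_eq.symm

/-- If a form is a multiple of a form, the cofactor can be replaced by a form. -/
theorem eq_homogeneousComponent_mul {σ : Type*} {b c u : MvPolynomial σ k} {m e : ℕ}
    (hu : u.IsHomogeneous e) (hb : b.IsHomogeneous (m + e)) (h : b = c * u) :
    b = homogeneousComponent m c * u := by
  rw [← homogeneousComponent_add_mul hu, ← h, homogeneousComponent_eq_self hb]

/-- The degree `n + d` part of an ideal generated by three forms of degree `d`. -/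
theorem map_dotMap_formTriples {w : Fin 3 → MvPolynomial (Fin 3) k} {d : ℕ}
    (hw : ∀ i, (w i).IsHomogeneous d) (n : ℕ) :
    (formTriples k n).map (dotMap w) =
      homogeneousSubmodule (Fin 3) k (n + d) ⊓ (Ideal.span (Set.range w)).restrictScalars k := by
  ext a
  constructor
  · rintro ⟨h, hh, rfl⟩
    have hh' := mem_formTriples.1 hh
    refine ⟨?_, ?_⟩
    · rw [SetLike.mem_coe, dotMap_apply]
      exact (((hh' 0).mul (hw 0)).add ((hh' 1).mul (hw 1))).add ((hh' 2).mul (hw 2))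
    · simp only [Submodule.coe_restrictScalars, SetLike.mem_coe, dotMap_apply]
      have hs : ∀ i, w i ∈ Ideal.span (Set.range w) := fun i => Ideal.subset_span ⟨i, rfl⟩
      exact add_mem (add_mem (Ideal.mul_mem_left _ _ (hs 0)) (Ideal.mul_mem_left _ _ (hs 1)))
        (Ideal.mul_mem_left _ _ (hs 2))
  · rintro ⟨ha, haJ⟩
    obtain ⟨c, hc⟩ := (Submodule.mem_span_range_iff_exists_fun _).1 haJ
    refine ⟨fun i => homogeneousComponent n (c i),
      mem_formTriples.2 fun i => homogeneousComponent_isHomogeneous _ _, ?_⟩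
    have := congrArg (homogeneousComponent (n + d)) hc
    rw [homogeneousComponent_eq_self ha] at this
    rw [dotMap_apply, ← this]
    simp [Fin.sum_univ_three, homogeneousComponent_add_mul (hw _)]

/-- Two coprime polynomials, the first a form of degree `e`, have multiples by forms of degree
`m + e` that span a space of dimension at least `2 D(m + e) - D(m)`, where `D(n)` is the dimension
of the space of forms of degree `n`. -/
theorem le_finrank_map_coprod {u v : MvPolynomial (Fin 3) k} {e : ℕ} (hu : u.IsHomogeneous e)
    (hu0 : u ≠ 0) (huv : ∀ q, Prime q → q ∣ u → ¬ q ∣ v) (m : ℕ) :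
    2 * Module.finrank k (homogeneousSubmodule (Fin 3) k (m + e)) ≤
      Module.finrank k (((homogeneousSubmodule (Fin 3) k (m + e)).prod
        (homogeneousSubmodule (Fin 3) k (m + e))).map
          ((LinearMap.mulRight k u).coprod (LinearMap.mulRight k v))) +
      Module.finrank k (homogeneousSubmodule (Fin 3) k m) := by
  set H := homogeneousSubmodule (Fin 3) k
  set L := (LinearMap.mulRight k u).coprod (LinearMap.mulRight k v)
  have hprod : Module.finrank k ((H (m + e)).prod (H (m + e))) =
      2 * Module.finrank k (H (m + e)) := by
    have E : ((H (m + e)).prod (H (m + e))) ≃ₗ[k] H (m + e) × H (m + e) :=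
      { toFun := fun x => (⟨x.1.1, x.2.1⟩, ⟨x.1.2, x.2.2⟩)
        invFun := fun x => ⟨(x.1.1, x.2.1), x.1.2, x.2.2⟩
        map_add' := fun _ _ => rfl
        map_smul' := fun _ _ => rfl }
    rw [E.finrank_eq, Module.finrank_prod, two_mul]
  have hfin : FiniteDimensional k ((H (m + e)).prod (H (m + e))) :=
    Module.Finite.iff_fg.2 ((homogeneousSubmodule_fg (Fin 3) k _).prod
      (homogeneousSubmodule_fg (Fin 3) k _))
  have hker : ((H (m + e)).prod (H (m + e)) ⊓ LinearMap.ker L : Submodule k _) ≤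
      (H m).map ((LinearMap.mulRight k (-v)).prod (LinearMap.mulRight k u)) := by
    rintro ⟨a, b⟩ ⟨⟨-, hb⟩, hab⟩
    have hab' : a * u + b * v = 0 := hab
    have hcop : NoCommonPrime ![u, v] := by
      intro q hq
      by_cases hqu : q ∣ u
      · exact ⟨1, huv q hq hqu⟩
      · exact ⟨0, hqu⟩
    obtain ⟨c, hc⟩ := hcop.dvd_of_forall_dvd_mul ⟨0, hu0⟩ u b (fun j => by
      fin_cases j
      · exact dvd_mul_right u b
      · exact ⟨-a, by simp; linear_combination hab'⟩)
    rw [mul_comm] at hc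
    have hb' : b = homogeneousComponent m c * u := eq_homogeneousComponent_mul hu hb hc
    refine ⟨homogeneousComponent m c, homogeneousComponent_mem _ _, ?_⟩
    refine Prod.ext (mul_right_cancel₀ hu0 ?_) hb'.symm
    change homogeneousComponent m c * -v * u = a * u
    rw [hb'] at hab'
    linear_combination -hab'
  have h1 := finrank_map_add_finrank_inf_ker L ((H (m + e)).prod (H (m + e)))
  have h2 := (Submodule.finrank_mono hker).trans (Submodule.finrank_map_le _ _)
  rw [hprod] at h1
  omega

/-- Let `g` be a triple of coprime forms of degree `e` with `∑ gᵢ wᵢ = 0`. On the triples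
orthogonal to `w` the kernel of the vector product with `g` consists of the multiples of `g`. -/
theorem finrank_map_crossMap {w g : Fin 3 → MvPolynomial (Fin 3) k} {d e : ℕ}
    (hg : ∀ i, (g i).IsHomogeneous e) (hwg : g 0 * w 0 + g 1 * w 1 + g 2 * w 2 = 0) (hgp : NoCommonPrime g)
    (hg0 : ∃ i, g i ≠ 0) (m : ℕ) :
    Module.finrank k ((formTriples k (m + d + e) ⊓ LinearMap.ker (dotMap w) : Submodule k _).map
      (crossMap g)) + Module.finrank k (homogeneousSubmodule (Fin 3) k (m + d)) =
    Module.finrank k (formTriples k (m + d + e) ⊓ LinearMap.ker (dotMap w) : Submodule k _) := by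
  obtain ⟨i, hi⟩ := hg0
  have hker : (formTriples k (m + d + e) ⊓ LinearMap.ker (dotMap w) : Submodule k _) ⊓
      LinearMap.ker (crossMap g) = (homogeneousSubmodule (Fin 3) k (m + d)).map (smulMap g) := by
    ext h
    symm
    constructor
    · rintro ⟨c, hc, rfl⟩
      refine ⟨⟨mem_formTriples.2 fun j => hc.mul (hg j), ?_⟩, ?_⟩
      · rw [SetLike.mem_coe, LinearMap.mem_ker, dotMap_apply]
        simp only [smulMap_apply]
        linear_combination c * hwg
      · rw [SetLike.mem_coe, LinearMap.mem_ker, crossMap_apply]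
        simp only [smulMap_apply]
        ext j
        fin_cases j <;> simp <;> ring_nf
    · rintro ⟨⟨hh, -⟩, hcr⟩
      rw [SetLike.mem_coe, mem_formTriples] at hh
      rw [SetLike.mem_coe, LinearMap.mem_ker, crossMap_apply] at hcr
      have h0 := congrFun hcr 0
      have h1 := congrFun hcr 1
      have h2 := congrFun hcr 2
      simp at h0 h1 h2
      obtain ⟨c, hc⟩ := hgp.exists_eq_mul (h := h) ⟨i, hi⟩ (fun a b => by
        fin_cases a <;> fin_cases b <;> simp <;>
          first
          | linear_combination h0 | linear_combination -h0 | linear_combination h1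
          | linear_combination -h1 | linear_combination h2 | linear_combination -h2)
      exact ⟨homogeneousComponent (m + d) c, homogeneousComponent_mem _ _,
        funext fun j => (eq_homogeneousComponent_mul (hg j) (hh j) (hc j)).symm⟩
  rw [← finrank_map_add_finrank_inf_ker (crossMap g)
    (formTriples k (m + d + e) ⊓ LinearMap.ker (dotMap w) : Submodule k _), hker,
    finrank_map_smulMap hi]

/-- The vector product of two triples orthogonal to a triple `w` of coprime forms is a multiple of
`w`. -/
theorem finrank_map_crossMap_le {w g : Fin 3 → MvPolynomial (Fin 3) k} {d e : ℕ}
    (hw : ∀ i, (w i).IsHomogeneous d) (hg : ∀ i, (g i).IsHomogeneous e)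
    (hwg : g 0 * w 0 + g 1 * w 1 + g 2 * w 2 = 0) (hwp : NoCommonPrime w)
    (hw0 : ∃ i, w i ≠ 0) (m : ℕ) :
    Module.finrank k ((formTriples k (m + d + e) ⊓ LinearMap.ker (dotMap w) : Submodule k _).map
      (crossMap g)) ≤ Module.finrank k (homogeneousSubmodule (Fin 3) k (m + 2 * e)) := by
  obtain ⟨i, hi⟩ := hw0
  rw [← finrank_map_smulMap hi]
  refine Submodule.finrank_mono ?_
  rintro _ ⟨h, ⟨hh, hdot⟩, rfl⟩
  rw [SetLike.mem_coe, mem_formTriples] at hh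
  rw [SetLike.mem_coe, LinearMap.mem_ker, dotMap_apply] at hdot
  have hcr : ∀ j, (crossMap g h j).IsHomogeneous (m + 2 * e + d) := by
    have h' : ∀ a b, (g a * h b).IsHomogeneous (m + 2 * e + d) := fun a b => by
      have := (hg a).mul (hh b)
      rwa [show e + (m + d + e) = m + 2 * e + d by omega] at this
    intro j
    rw [crossMap_apply]
    fin_cases j
    exacts [(h' _ _).sub (h' _ _), (h' _ _).sub (h' _ _), (h' _ _).sub (h' _ _)]
  -- Both `g` and `h` are orthogonal to `w`, so `w × (g × h) = 0`.
  obtain ⟨c, hc⟩ := hwp.exists_eq_mul (h := crossMap g h) ⟨i, hi⟩ (fun a b => by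
    rw [crossMap_apply]
    fin_cases a <;> fin_cases b <;> simp
    · linear_combination g 2 * hdot - h 2 * hwg
    · linear_combination -g 1 * hdot + h 1 * hwg
    · linear_combination -g 2 * hdot + h 2 * hwg
    · linear_combination g 0 * hdot - h 0 * hwg
    · linear_combination g 1 * hdot - h 1 * hwg
    · linear_combination -g 0 * hdot + h 0 * hwg)
  exact ⟨homogeneousComponent (m + 2 * e) c, homogeneousComponent_mem _ _,
    funext fun j => (eq_homogeneousComponent_mul (hw j) (hcr j) (hc j)).symm⟩

/-- The vector products `g × h`, for `h` orthogonal to `w`, include all multiples of `w` by elements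
of the ideal `(g₀, g₁, g₂)`, which contains two coprime forms of degree `e`. -/
theorem le_finrank_map_crossMap [Infinite k] {w g : Fin 3 → MvPolynomial (Fin 3) k} {d e : ℕ}
    (hw : ∀ i, (w i).IsHomogeneous d) (hg : ∀ i, (g i).IsHomogeneous e)
    (hwg : g 0 * w 0 + g 1 * w 1 + g 2 * w 2 = 0) (hw0 : ∃ i, w i ≠ 0) (hgp : NoCommonPrime g)
    (hg0 : ∃ i, g i ≠ 0) (m : ℕ) :
    2 * Module.finrank k (homogeneousSubmodule (Fin 3) k (m + e)) ≤
    Module.finrank k ((formTriples k (m + d + e) ⊓ LinearMap.ker (dotMap w) : Submodule k _).map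
      (crossMap g)) + Module.finrank k (homogeneousSubmodule (Fin 3) k m) := by
  obtain ⟨i, hi⟩ := hg0
  obtain ⟨l, hl⟩ := hw0
  obtain ⟨c, hc⟩ := hgp.exists_not_dvd_add_smul (k := k) hi
  refine (le_finrank_map_coprod (hg i) hi hc m).trans ?_
  rw [← finrank_map_smulMap hl]
  refine Nat.add_le_add_right (Submodule.finrank_mono ?_) _
  rintro _ ⟨_, ⟨⟨a, b⟩, ⟨ha, hb⟩, rfl⟩, rfl⟩
  -- `(∑ bⱼ gⱼ) w = g × (w × b)` for every triple `b`.
  have key : ∀ b : Fin 3 → MvPolynomial (Fin 3) k, (∀ j, (b j).IsHomogeneous (m + e)) →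
      smulMap w (b 0 * g 0 + b 1 * g 1 + b 2 * g 2) ∈
        (formTriples k (m + d + e) ⊓ LinearMap.ker (dotMap w) : Submodule k _).map
          (crossMap g) := by
    intro b hb
    refine ⟨crossMap w b, ⟨mem_formTriples.2 fun j => ?_, ?_⟩, ?_⟩
    · have h' : ∀ x y, (w x * b y).IsHomogeneous (m + d + e) := fun x y => by
        have := (hw x).mul (hb y)
        rwa [show d + (m + e) = m + d + e by omega] at this
      rw [crossMap_apply]
      fin_cases j
      exacts [(h' _ _).sub (h' _ _), (h' _ _).sub (h' _ _), (h' _ _).sub (h' _ _)]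
    · rw [SetLike.mem_coe, LinearMap.mem_ker, dotMap_apply, crossMap_apply]
      simp
      ring
    · ext1 j
      rw [crossMap_apply, crossMap_apply, smulMap_apply]
      fin_cases j <;> simp
      · linear_combination -b 0 * hwg
      · linear_combination -b 1 * hwg
      · linear_combination -b 2 * hwg
  have ha' : a.IsHomogeneous (m + e) := ha
  have hb' : b.IsHomogeneous (m + e) := hb
  have hcb : (c • b).IsHomogeneous (m + e) :=
    (homogeneousSubmodule (Fin 3) k (m + e)).smul_mem c hb
  fin_cases i
  · convert key ![a, b, c • b] (fun j => by fin_cases j <;> assumption) using 2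
    simp [smul_eq_C_mul]
    ring
  · convert key ![c • b, a, b] (fun j => by fin_cases j <;> assumption) using 2
    simp [smul_eq_C_mul]
    ring
  · convert key ![b, c • b, a] (fun j => by fin_cases j <;> assumption) using 2
    simp [smul_eq_C_mul]
    ring

/-- The Hilbert function `n ↦ dim_k (R/J)_n` of the quotient by an ideal `J`, for `R = k[x, y, z]`:
the codimension of `J ∩ R_n` in the space `R_n` of forms of degree `n`. -/
noncomputable def hilbertFn (J : Ideal (MvPolynomial (Fin 3) k)) (n : ℕ) : ℕ :=
  Module.finrank k ((homogeneousSubmodule (Fin 3) k n).map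
    (Ideal.Quotient.mkₐ k J).toLinearMap)

theorem hilbertFn_add_finrank (J : Ideal (MvPolynomial (Fin 3) k)) (n : ℕ) :
    hilbertFn J n + Module.finrank k
      (homogeneousSubmodule (Fin 3) k n ⊓ J.restrictScalars k : Submodule k _) =
      Module.finrank k (homogeneousSubmodule (Fin 3) k n) := by
  have hker : LinearMap.ker (Ideal.Quotient.mkₐ k J).toLinearMap = J.restrictScalars k := by
    ext a
    simp [Ideal.Quotient.eq_zero_iff_mem]
  have := finrank_map_add_finrank_inf_ker (Ideal.Quotient.mkₐ k J).toLinearMap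
    (homogeneousSubmodule (Fin 3) k n)
  rwa [hker] at this

/-- Bounds for the Hilbert function of `R/(w₀, w₁, w₂)`, for a triple `w` of coprime forms of degree
`d`, in terms of a syzygy of degree `e` with coprime entries. The degree is `n + d` with
`n = m + d + e`, and the bounds hold for every `m`, not only in large degrees. -/
theorem hilbertFn_bounds [Infinite k] {w g : Fin 3 → MvPolynomial (Fin 3) k} {d e : ℕ}
    (hw : ∀ i, (w i).IsHomogeneous d) (hg : ∀ i, (g i).IsHomogeneous e)
    (hwg : g 0 * w 0 + g 1 * w 1 + g 2 * w 2 = 0) (hwp : NoCommonPrime w)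
    (hw0 : ∃ i, w i ≠ 0) (hgp : NoCommonPrime g) (hg0 : ∃ i, g i ≠ 0) (m : ℕ) :
    (d : ℤ) * ((d : ℤ) - e) ≤ hilbertFn (Ideal.span (Set.range w)) (m + d + e + d) ∧
      (hilbertFn (Ideal.span (Set.range w)) (m + d + e + d) : ℤ) ≤
        (d : ℤ) ^ 2 + (e : ℤ) * ((e : ℤ) - d) := by
  have h1 := hilbertFn_add_finrank (Ideal.span (Set.range w)) (m + d + e + d)
  rw [← map_dotMap_formTriples hw] at h1
  have h2 := finrank_map_add_finrank_inf_ker (dotMap w) (formTriples k (m + d + e))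
  rw [finrank_formTriples] at h2
  have h3 := finrank_map_crossMap (d := d) hg hwg hgp hg0 m
  have h4 := finrank_map_crossMap_le hw hg hwg hwp hw0 m
  have h5 := le_finrank_map_crossMap hw hg hwg hw0 hgp hg0 m
  have D := two_mul_finrank_homogeneousSubmodule (k := k)
  have D1 := D (m + d + e + d)
  have D2 := D (m + d + e)
  have D3 := D (m + d)
  have D4 := D (m + 2 * e)
  have D5 := D (m + e)
  have D6 := D m
  zify at h1 h2 h3 h4 h5 D1 D2 D3 D4 D5 D6
  constructor
  · linarith
  · linarith

/-! ### Zeros of homogeneous ideals in the plane -/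

theorem aeval_const_mul {σ S : Type*} [CommRing S] [Algebra k S] {a : MvPolynomial σ k} {n : ℕ}
    (ha : a.IsHomogeneous n) (u : S) (y : σ → S) :
    aeval (fun i => u * y i) a = u ^ n * aeval y a := by
  classical
  rw [aeval_def, aeval_def, eval₂_eq, eval₂_eq, Finset.mul_sum]
  refine Finset.sum_congr rfl fun m hm => ?_
  simp_rw [mul_pow]
  rw [Finset.prod_mul_distrib, Finset.prod_pow_eq_pow_sum, ← ha.degree_eq_sum_deg_support hm]
  ring

theorem eval_const_mul {σ : Type*} {a : MvPolynomial σ k} {n : ℕ} (ha : a.IsHomogeneous n) (u : k)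
    (y : σ → k) : eval (fun i => u * y i) a = u ^ n * eval y a := by
  simpa [coe_aeval_eq_eval] using aeval_const_mul ha u y

/-- An ideal generated by forms of degree `d` is homogeneous. -/
theorem homogeneousComponent_mem_span {ι : Type*} [Fintype ι] {w : ι → MvPolynomial (Fin 3) k}
    {d : ℕ} (hw : ∀ i, (w i).IsHomogeneous d) {a : MvPolynomial (Fin 3) k}
    (ha : a ∈ Ideal.span (Set.range w)) (n : ℕ) :
    homogeneousComponent n a ∈ Ideal.span (Set.range w) := by
  obtain ⟨c, rfl⟩ := (Submodule.mem_span_range_iff_exists_fun _).1 ha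
  rw [map_sum]
  refine sum_mem fun i _ => ?_
  rw [smul_eq_mul]
  rcases lt_or_ge n d with h | h
  · rw [homogeneousComponent_mul_of_lt (hw i) h]
    exact zero_mem _
  · obtain ⟨m, rfl⟩ := Nat.exists_eq_add_of_le' h
    rw [homogeneousComponent_add_mul (hw i)]
    exact Ideal.mul_mem_left _ _ (Ideal.subset_span ⟨i, rfl⟩)

section Points

/-- The points of the projective plane at which an ideal vanishes, tested on the chosen
representatives; for a homogeneous ideal the choice is immaterial. -/
def projZeros (J : Ideal (MvPolynomial (Fin 3) k)) : Set (ℙ k (Fin 3 → k)) :=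
  {p | ∀ a ∈ J, eval p.rep a = 0}

/-- The linear form with given coefficients. -/
noncomputable def linForm (c : Fin 3 → k) : MvPolynomial (Fin 3) k := ∑ i, C (c i) * X i

theorem linForm_isHomogeneous (c : Fin 3 → k) : (linForm c).IsHomogeneous 1 :=
  IsHomogeneous.sum _ _ _ fun _ _ => isHomogeneous_C_mul_X _ _

theorem eval_linForm (c v : Fin 3 → k) : eval v (linForm c) = ∑ i, c i * v i := by
  simp [linForm]

theorem exists_linearForm_separating {p q : ℙ k (Fin 3 → k)} (h : p ≠ q) :
    ∃ l : MvPolynomial (Fin 3) k, l.IsHomogeneous 1 ∧ eval q.rep l = 0 ∧ eval p.rep l ≠ 0 := by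
  by_contra! hcon
  obtain ⟨i, hi⟩ := exists_rep_ne_zero q
  have key : ∀ j, q.rep i * p.rep j = q.rep j * p.rep i := by
    intro j
    have := hcon (C (q.rep i) * X j - C (q.rep j) * X i)
      ((isHomogeneous_C_mul_X _ _).sub (isHomogeneous_C_mul_X _ _)) (by simp; ring)
    simpa [sub_eq_zero] using this
  apply h
  rw [← p.mk_rep, ← q.mk_rep, Projectivization.mk_eq_mk_iff']
  refine ⟨p.rep i / q.rep i, funext fun j => ?_⟩
  rw [Pi.smul_apply, smul_eq_mul, div_mul_eq_mul_div, div_eq_iff hi]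
  linear_combination -key j

theorem exists_form_separating (S : Finset (ℙ k (Fin 3 → k))) {p : ℙ k (Fin 3 → k)} (hp : p ∉ S)
    {n : ℕ} (hn : S.card ≤ n) : ∃ G : MvPolynomial (Fin 3) k, G.IsHomogeneous n ∧
      (∀ q ∈ S, eval q.rep G = 0) ∧ eval p.rep G ≠ 0 := by
  choose l hl using fun q : S => exists_linearForm_separating (p := p) (q := q.1)
    (fun h => hp (h ▸ q.2))
  obtain ⟨i, hi⟩ := exists_rep_ne_zero p
  refine ⟨(∏ q, l q) * X i ^ (n - S.card), ?_, fun q hq => ?_, ?_⟩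
  · have h1 := IsHomogeneous.prod Finset.univ l (fun _ => 1) fun q _ => (hl q).1
    have h2 := h1.mul (isHomogeneous_X_pow (R := k) i (n - S.card))
    simpa [Nat.add_sub_cancel' hn] using h2
  · rw [map_mul, map_prod, Finset.prod_eq_zero (Finset.mem_univ ⟨q, hq⟩) (hl ⟨q, hq⟩).2.1, zero_mul]
  · rw [map_mul, map_prod, map_pow, eval_X]
    exact mul_ne_zero (Finset.prod_ne_zero_iff.2 fun q _ => (hl q).2.2) (pow_ne_zero _ hi)

/-- Finitely many points impose independent conditions on forms of large degree. -/
theorem card_le_hilbertFn {J : Ideal (MvPolynomial (Fin 3) k)} (S : Finset (ℙ k (Fin 3 → k)))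
    (hS : ∀ p ∈ S, p ∈ projZeros J) {n : ℕ} (hn : S.card ≤ n) : S.card ≤ hilbertFn J n := by
  classical
  let E : MvPolynomial (Fin 3) k →ₗ[k] (S → k) :=
    LinearMap.pi fun p => (aeval (R := k) p.1.rep).toLinearMap
  have hE : ∀ a p, E a p = eval p.1.rep a := fun a p => by simp [E]
  have htop : (homogeneousSubmodule (Fin 3) k n).map E = ⊤ := by
    rw [eq_top_iff, ← (Pi.basisFun k S).span_eq, Submodule.span_le]
    rintro _ ⟨p, rfl⟩
    obtain ⟨G, hG, hG0, hGp⟩ := exists_form_separating (S.erase p.1) (S.notMem_erase p.1)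
      ((Finset.card_erase_le).trans hn)
    refine ⟨(eval p.1.rep G)⁻¹ • G, Submodule.smul_mem _ _ hG, funext fun q => ?_⟩
    rw [map_smul, Pi.smul_apply, hE, Pi.basisFun_apply, smul_eq_mul]
    rcases eq_or_ne q p with rfl | hqp
    · rw [Pi.single_eq_same, inv_mul_cancel₀ hGp]
    · rw [Pi.single_eq_of_ne hqp, hG0 q.1 (Finset.mem_erase.2 ⟨fun h => hqp (Subtype.ext h), q.2⟩),
        mul_zero]
  have h1 := finrank_map_add_finrank_inf_ker E (homogeneousSubmodule (Fin 3) k n)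
  rw [htop, finrank_top, Module.finrank_fintype_fun_eq_card, Fintype.card_coe] at h1
  have h2 := hilbertFn_add_finrank J n
  have h3 : Module.finrank k
      (homogeneousSubmodule (Fin 3) k n ⊓ J.restrictScalars k : Submodule k _) ≤
      Module.finrank k (homogeneousSubmodule (Fin 3) k n ⊓ LinearMap.ker E : Submodule k _) := by
    refine Submodule.finrank_mono (inf_le_inf_left _ fun a ha => ?_)
    rw [LinearMap.mem_ker]
    exact funext fun p => (hE a p).trans (hS p.1 p.2 a ha)
  omega

theorem projZeros_finite {J : Ideal (MvPolynomial (Fin 3) k)} {N b : ℕ}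
    (h : ∀ n, N ≤ n → hilbertFn J n ≤ b) : (projZeros J).Finite := by
  by_contra hinf
  obtain ⟨S, hS, hcard⟩ := Set.Infinite.exists_subset_card_eq hinf (b + 1)
  have h1 := card_le_hilbertFn S (fun p hp => hS hp) (n := N + (b + 1)) (by omega)
  have h2 := h (N + (b + 1)) (by omega)
  omega

theorem exists_linForm_ne_zero [Infinite k] {T : Set (ℙ k (Fin 3 → k))} (hT : T.Finite) :
    ∃ c : Fin 3 → k, ∀ p ∈ T, eval p.rep (linForm c) ≠ 0 := by
  have hne : ∏ p ∈ hT.toFinset, linForm p.rep ≠ 0 := by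
    refine Finset.prod_ne_zero_iff.2 fun p _ h0 => ?_
    obtain ⟨i, hi⟩ := exists_rep_ne_zero p
    have := congrArg (eval (Pi.single i 1)) h0
    rw [eval_linForm] at this
    simp [Pi.single_apply] at this
    exact hi this
  obtain ⟨c, hc⟩ : ∃ c : Fin 3 → k, eval c (∏ p ∈ hT.toFinset, linForm p.rep) ≠ 0 := by
    by_contra! hcon
    exact hne (MvPolynomial.funext fun c => by rw [hcon c, map_zero])
  refine ⟨c, fun p hp => ?_⟩
  rw [map_prod, Finset.prod_ne_zero_iff] at hc
  have := hc p (hT.mem_toFinset.2 hp)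
  rw [eval_linForm] at this ⊢
  simpa [mul_comm] using this

end Points

/-! ### From the graded ring `R/J` to an affine algebra -/

section Stabilization

variable {w : Fin 3 → MvPolynomial (Fin 3) k} {d : ℕ} {l : MvPolynomial (Fin 3) k}

/-- By the Nullstellensatz, an ideal whose only zero is the origin contains all forms of large
degree. -/
theorem exists_forall_form_mem [IsAlgClosed k] {I : Ideal (MvPolynomial (Fin 3) k)}
    (hI : ∀ v, (∀ a ∈ I, eval v a = 0) → v = 0) :
    ∃ N, ∀ n, N ≤ n → ∀ a : MvPolynomial (Fin 3) k, a.IsHomogeneous n → a ∈ I := by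
  have hrad : Ideal.span (Set.range (X : Fin 3 → MvPolynomial (Fin 3) k)) ≤ I.radical := by
    rw [← vanishingIdeal_zeroLocus_eq_radical (K := k), Ideal.span_le]
    rintro _ ⟨i, rfl⟩ v hv
    have hv0 := hI v fun a ha => by simpa [coe_aeval_eq_eval] using hv a ha
    simp [hv0]
  obtain ⟨N, hN⟩ := Ideal.exists_pow_le_of_le_radical_of_fg hrad
    (Submodule.fg_span (Set.finite_range _))
  refine ⟨N, fun n hn a ha => hN (Ideal.pow_le_pow_right hn ?_)⟩
  rw [Ideal.mem_span_pow_iff_exists_isHomogeneous]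
  refine ⟨map C a, ha.map C, ?_⟩
  rw [eval_map, eval₂_eta]

/-- If a linear form `l` has no common zeros with `J` besides the origin, then forms of large
degree are divisible by `l` modulo `J`. -/
theorem exists_forall_eq_add_mul [IsAlgClosed k] (hw : ∀ i, (w i).IsHomogeneous d)
    (hl : l.IsHomogeneous 1)
    (hlw : ∀ v, (∀ i, eval v (w i) = 0) → eval v l = 0 → v = 0) :
    ∃ N, ∀ n, N ≤ n → ∀ a : MvPolynomial (Fin 3) k, a.IsHomogeneous (n + 1) →
      ∃ b : MvPolynomial (Fin 3) k, b.IsHomogeneous n ∧ a - b * l ∈ Ideal.span (Set.range w) := by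
  obtain ⟨N, hN⟩ := exists_forall_form_mem (I := Ideal.span (Set.range w) ⊔ Ideal.span {l})
    fun v hv => hlw v (fun i => hv _ (Ideal.mem_sup_left (Ideal.subset_span ⟨i, rfl⟩)))
      (hv _ (Ideal.mem_sup_right (Ideal.mem_span_singleton_self l)))
  refine ⟨N, fun n hn a ha => ?_⟩
  obtain ⟨j, hj, c, hc, rfl⟩ := Submodule.mem_sup.1 (hN (n + 1) (by omega) a ha)
  obtain ⟨b, rfl⟩ := Ideal.mem_span_singleton'.1 hc
  refine ⟨homogeneousComponent n b, homogeneousComponent_isHomogeneous _ _, ?_⟩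
  have := homogeneousComponent_eq_self ha
  rw [map_add, homogeneousComponent_add_mul hl] at this
  rw [← this, add_sub_cancel_right]
  exact homogeneousComponent_mem_span hw hj _

/-- If forms of large degree are divisible by `l` modulo `J`, then multiplication by `l` on `R/J` is
injective in large degrees: it is surjective there, so that the Hilbert function decreases until it
becomes constant. -/
theorem exists_forall_mem_of_mul_mem (hl : l.IsHomogeneous 1) {J : Ideal (MvPolynomial (Fin 3) k)}
    {N : ℕ} (hN : ∀ n, N ≤ n → ∀ a : MvPolynomial (Fin 3) k, a.IsHomogeneous (n + 1) →
      ∃ b : MvPolynomial (Fin 3) k, b.IsHomogeneous n ∧ a - b * l ∈ J) :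
    ∃ M, N ≤ M ∧
      ∀ n, M ≤ n → ∀ a : MvPolynomial (Fin 3) k, a.IsHomogeneous n → a * l ∈ J → a ∈ J := by
  let Q : ℕ → Submodule k (MvPolynomial (Fin 3) k ⧸ J) := fun n =>
    (homogeneousSubmodule (Fin 3) k n).map (Ideal.Quotient.mkₐ k J).toLinearMap
  let μ := LinearMap.mulRight k (Ideal.Quotient.mk J l)
  have hQ : ∀ n, N ≤ n → (Q n).map μ = Q (n + 1) := by
    intro n hn
    apply le_antisymm
    · rintro _ ⟨_, ⟨a, ha, rfl⟩, rfl⟩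
      exact ⟨a * l, ha.mul hl, map_mul (Ideal.Quotient.mk J) a l⟩
    · rintro _ ⟨a, ha, rfl⟩
      obtain ⟨b, hb, hab⟩ := hN n hn a ha
      refine ⟨Ideal.Quotient.mk J b, ⟨b, hb, rfl⟩, ?_⟩
      change Ideal.Quotient.mk J b * Ideal.Quotient.mk J l = Ideal.Quotient.mk J a
      rw [← map_mul]
      exact (Ideal.Quotient.eq.2 hab).symm
  have hrank : ∀ n, N ≤ n → hilbertFn J (n + 1) +
      Module.finrank k (Q n ⊓ LinearMap.ker μ : Submodule k _) = hilbertFn J n := by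
    intro n hn
    have := finrank_map_add_finrank_inf_ker μ (Q n)
    rwa [hQ n hn] at this
  obtain ⟨M, hM⟩ : ∃ M, ∀ n, N + M ≤ n → hilbertFn J n = hilbertFn J (N + M) := by
    have hanti : Antitone fun m => hilbertFn J (N + m) :=
      antitone_nat_of_succ_le fun m => by
        have := hrank (N + m) (by omega)
        rw [← add_assoc]
        omega
    obtain ⟨M, hM⟩ := WellFoundedLT.antitone_chain_condition hanti
    refine ⟨M, fun n hn => ?_⟩
    obtain ⟨m, rfl⟩ := Nat.exists_eq_add_of_le (show N ≤ n by omega)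
    exact (hM m (by omega)).symm
  refine ⟨N + M, by omega, fun n hn a ha hal => ?_⟩
  have h1 := hrank n (by omega)
  rw [hM n hn, hM (n + 1) (by omega), Nat.add_eq_left, Submodule.finrank_eq_zero] at h1
  rw [← Ideal.Quotient.eq_zero_iff_mem, ← Submodule.mem_bot (R := k), ← h1]
  refine ⟨⟨a, ha, rfl⟩, ?_⟩
  rw [SetLike.mem_coe, LinearMap.mem_ker]
  change Ideal.Quotient.mk J a * Ideal.Quotient.mk J l = 0
  rw [← map_mul]
  exact Ideal.Quotient.eq_zero_iff_mem.2 hal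

/-- A form that vanishes in `R/(J + (l - 1))` is killed by a power of `l` modulo `J`: the ring
homomorphism `x ↦ x / l` to the localization of `R/J` at `l` factors through `R/(J + (l - 1))`. -/
theorem exists_mul_pow_mem (hw : ∀ i, (w i).IsHomogeneous d) (hl : l.IsHomogeneous 1) {n : ℕ}
    {a : MvPolynomial (Fin 3) k} (ha : a.IsHomogeneous n)
    (haI : a ∈ Ideal.span (Set.range w) ⊔ Ideal.span {l - 1}) :
    ∃ s, a * l ^ s ∈ Ideal.span (Set.range w) := by
  set J := Ideal.span (Set.range w)
  let A := Localization.Away (Ideal.Quotient.mk J l)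
  let y : MvPolynomial (Fin 3) k →ₐ[k] A :=
    (IsScalarTower.toAlgHom k (MvPolynomial (Fin 3) k ⧸ J) A).comp (Ideal.Quotient.mkₐ k J)
  have hy : ∀ b, y b = algebraMap (MvPolynomial (Fin 3) k ⧸ J) A (Ideal.Quotient.mk J b) :=
    fun b => rfl
  let u : A := IsLocalization.Away.invSelf (Ideal.Quotient.mk J l)
  have hu : u * y l = 1 := by
    rw [hy, mul_comm]
    exact IsLocalization.Away.mul_invSelf _
  let θ : MvPolynomial (Fin 3) k →ₐ[k] A := aeval fun i => u * y (X i)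
  have hθ : ∀ {b : MvPolynomial (Fin 3) k} {m : ℕ}, b.IsHomogeneous m → θ b = u ^ m * y b := by
    intro b m hb
    have := aeval_const_mul hb u fun i => y (X i)
    rwa [show aeval (fun i => y (X i)) = y from (aeval_unique y).symm] at this
  have hker : J ⊔ Ideal.span {l - 1} ≤ RingHom.ker θ := by
    refine sup_le (Ideal.span_le.2 ?_) (Ideal.span_le.2 ?_)
    · rintro _ ⟨i, rfl⟩
      have hi : w i ∈ J := Ideal.subset_span ⟨i, rfl⟩
      rw [SetLike.mem_coe, RingHom.mem_ker, hθ (hw i), hy, Ideal.Quotient.eq_zero_iff_mem.2 hi, map_zero, mul_zero]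
    · rintro _ rfl
      rw [SetLike.mem_coe, RingHom.mem_ker, map_sub, map_one, hθ hl, pow_one, hu, sub_self]
  have h0 : y a = 0 := by
    have h1 := hker haI
    rw [RingHom.mem_ker, hθ ha] at h1
    have hun : IsUnit u := IsUnit.of_mul_eq_one _ hu
    exact (hun.pow n).mul_right_eq_zero.1 h1
  rw [hy, IsLocalization.map_eq_zero_iff (Submonoid.powers (Ideal.Quotient.mk J l))] at h0
  obtain ⟨⟨_, s, rfl⟩, hs⟩ := h0
  refine ⟨s, ?_⟩
  rw [← Ideal.Quotient.eq_zero_iff_mem, map_mul, map_pow, mul_comm]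
  exact hs

/-- The affine algebra `R/(J + (l - 1))` has dimension the eventual value of the Hilbert function
of `R/J`. -/
theorem finrank_quotient_eq_hilbertFn (hw : ∀ i, (w i).IsHomogeneous d) (hl : l.IsHomogeneous 1)
    {N : ℕ} (hN : ∀ n, N ≤ n → ∀ a : MvPolynomial (Fin 3) k, a.IsHomogeneous (n + 1) →
      ∃ b : MvPolynomial (Fin 3) k, b.IsHomogeneous n ∧ a - b * l ∈ Ideal.span (Set.range w)) :
    Module.Finite k (MvPolynomial (Fin 3) k ⧸ (Ideal.span (Set.range w) ⊔ Ideal.span {l - 1})) ∧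
    ∃ M, ∀ n, M ≤ n →
      Module.finrank k
        (MvPolynomial (Fin 3) k ⧸ (Ideal.span (Set.range w) ⊔ Ideal.span {l - 1})) =
        hilbertFn (Ideal.span (Set.range w)) n := by
  obtain ⟨M, hNM, hinj⟩ := exists_forall_mem_of_mul_mem hl hN
  set J := Ideal.span (Set.range w)
  set I := J ⊔ Ideal.span {l - 1}
  have hl1 : l - 1 ∈ I := Ideal.mem_sup_right (Ideal.mem_span_singleton_self _)
  let W : ℕ → Submodule k (MvPolynomial (Fin 3) k ⧸ I) := fun n =>
    (homogeneousSubmodule (Fin 3) k n).map (Ideal.Quotient.mkₐ k I).toLinearMap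
  have hmono : Monotone W := monotone_nat_of_le_succ fun n => by
    rintro _ ⟨a, ha, rfl⟩
    refine ⟨a * l, ha.mul hl, Ideal.Quotient.eq.2 ?_⟩
    have := I.mul_mem_left a hl1
    rwa [mul_sub, mul_one] at this
  have hanti : ∀ n, N ≤ n → W (n + 1) ≤ W n := by
    rintro n hn _ ⟨a, ha, rfl⟩
    obtain ⟨b, hb, hab⟩ := hN n hn a ha
    refine ⟨b, hb, (Ideal.Quotient.eq.2 ?_).symm⟩
    have h1 : a - b * l ∈ I := Ideal.mem_sup_left hab
    have := I.add_mem h1 (I.mul_mem_left b hl1)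
    rwa [show a - b * l + b * (l - 1) = a - b by ring] at this
  have hle : ∀ n, N ≤ n → ∀ m, W m ≤ W n := by
    intro n hn m
    rcases le_total m n with h | h
    · exact hmono h
    · induction m, h using Nat.le_induction with
      | base => exact le_rfl
      | succ m hm ih => exact (hanti m (hn.trans hm)).trans ih
  have htop : ∀ n, N ≤ n → W n = ⊤ := by
    intro n hn
    rw [eq_top_iff]
    rintro x -
    obtain ⟨a, rfl⟩ := Ideal.Quotient.mk_surjective x
    rw [← sum_homogeneousComponent a, map_sum]
    exact sum_mem fun m _ => hle n hn m ⟨_, homogeneousComponent_mem m a, rfl⟩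
  have hpow : ∀ s n, M ≤ n → ∀ a : MvPolynomial (Fin 3) k, a.IsHomogeneous n →
      a * l ^ s ∈ J → a ∈ J := by
    intro s
    induction s with
    | zero => intro n _ a _ h; simpa using h
    | succ s ih =>
      intro n hn a ha h
      rw [pow_succ', ← mul_assoc] at h
      exact hinj n hn a ha (ih (n + 1) (by omega) _ (ha.mul hl) h)
  refine ⟨⟨?_⟩, M, fun n hn => ?_⟩
  · rw [← htop N le_rfl]
    exact (homogeneousSubmodule_fg (Fin 3) k N).map _
  · have hker : (homogeneousSubmodule (Fin 3) k n ⊓ I.restrictScalars k : Submodule k _) =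
        homogeneousSubmodule (Fin 3) k n ⊓ J.restrictScalars k := by
      ext a
      refine ⟨fun ⟨ha, haI⟩ => ⟨ha, ?_⟩, fun ⟨ha, haJ⟩ => ⟨ha, (le_sup_left : J ≤ I) haJ⟩⟩
      obtain ⟨s, hs⟩ := exists_mul_pow_mem hw hl ha haI
      exact hpow s n hn a ha hs
    have h1 := hilbertFn_add_finrank I n
    have h2 := hilbertFn_add_finrank J n
    have h3 : hilbertFn I n = Module.finrank k (MvPolynomial (Fin 3) k ⧸ I) := by
      rw [← finrank_top k (MvPolynomial (Fin 3) k ⧸ I), ← htop n (hNM.trans hn)]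
      rfl
    rw [hker] at h1
    omega

end Stabilization

end Polynomials

/-! ### Local rings of affine schemes at points -/

/-- A `k`-algebra `S` with a family `y` of elements is the local ring at the point `v` of the
subscheme of affine space defined by the ideal `I`, expressed by its universal property among local
`k`-algebras with residue field `k`. -/
structure IsLocalRingAt {k : Type u} [Field k] {σ : Type} (I : Ideal (MvPolynomial σ k))
    (v : σ → k) (S : Type u) [CommRing S] [Algebra k S] (y : σ → S) : Prop where
  isLocalRing : IsLocalRing S
  exists_residue : ∃ ε : S →ₐ[k] k, ∀ i, ε (y i) = v i
  aeval_eq_zero : ∀ a ∈ I, aeval y a = 0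
  exists_lift : ∀ {P : Type u} [CommRing P] [Algebra k P] [IsLocalRing P] (ε : P →ₐ[k] k)
    (z : σ → P), (∀ i, ε (z i) = v i) → (∀ a ∈ I, aeval z a = 0) →
    ∃ φ : S →ₐ[k] P, ∀ i, φ (y i) = z i
  hom_ext : ∀ {P : Type u} [CommRing P] [Algebra k P] (φ ψ : S →ₐ[k] P),
    (∀ i, φ (y i) = ψ (y i)) → φ = ψ

section LocalRing

variable {k : Type u} [Field k]

/-- A homomorphism from a local `k`-algebra to `k` is its residue map. -/
theorem isUnit_of_residue_ne_zero {P : Type*} [CommRing P] [Algebra k P] [IsLocalRing P]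
    (ε : P →ₐ[k] k) {s : P} (hs : ε s ≠ 0) : IsUnit s := by
  by_contra h
  have hker : RingHom.ker ε = IsLocalRing.maximalIdeal P :=
    IsLocalRing.eq_maximalIdeal (RingHom.ker_isMaximal_of_surjective ε fun c =>
      ⟨algebraMap k P c, by simp⟩)
  have hmem := (IsLocalRing.mem_maximalIdeal s).2 h
  rw [← hker] at hmem
  exact hs hmem

theorem residue_aeval {σ P : Type*} [CommRing P] [Algebra k P] (ε : P →ₐ[k] k) {z : σ → P}
    {v : σ → k} (hz : ∀ i, ε (z i) = v i) (a : MvPolynomial σ k) : ε (aeval z a) = eval v a := by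
  rw [← coe_aeval_eq_eval, RingHom.coe_coe]
  have : ε.comp (aeval z) = aeval v := algHom_ext fun i => by simp [hz]
  exact DFunLike.congr_fun this a

theorem map_aeval {σ S P : Type*} [CommRing S] [Algebra k S] [CommRing P] [Algebra k P]
    (φ : S →ₐ[k] P) (z : σ → S) (a : MvPolynomial σ k) :
    φ (aeval z a) = aeval (fun i => φ (z i)) a := by
  have : φ.comp (aeval z) = aeval fun i => φ (z i) := algHom_ext fun i => by simp
  exact DFunLike.congr_fun this a

/-- The localization of a quotient of a polynomial ring at the ideal of a point. -/
theorem isLocalRingAt_localization_quotient {σ : Type} {I : Ideal (MvPolynomial σ k)} {v : σ → k}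
    (q : Ideal (MvPolynomial σ k ⧸ I)) [q.IsPrime]
    (hq : ∀ a, Ideal.Quotient.mk I a ∈ q ↔ eval v a = 0) :
    IsLocalRingAt I v (Localization.AtPrime q)
      fun i => algebraMap (MvPolynomial σ k ⧸ I) _ (Ideal.Quotient.mk I (X i)) := by
  set y : σ → Localization.AtPrime q := fun i =>
    algebraMap (MvPolynomial σ k ⧸ I) _ (Ideal.Quotient.mk I (X i))
  let ι : MvPolynomial σ k →ₐ[k] Localization.AtPrime q :=
    (IsScalarTower.toAlgHom k (MvPolynomial σ k ⧸ I) (Localization.AtPrime q)).comp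
      (Ideal.Quotient.mkₐ k I)
  have hι : aeval y = ι := (aeval_unique ι).symm
  have hlift : ∀ {P : Type u} [CommRing P] [Algebra k P] [IsLocalRing P] (ε : P →ₐ[k] k)
      (z : σ → P), (∀ i, ε (z i) = v i) → (∀ a ∈ I, aeval z a = 0) →
      ∃ φ : Localization.AtPrime q →ₐ[k] P, ∀ i, φ (y i) = z i := by
    intro P _ _ _ ε z hz hI
    let φ₀ : (MvPolynomial σ k ⧸ I) →ₐ[k] P := Ideal.Quotient.liftₐ I (aeval z) hI
    have hu : ∀ b : q.primeCompl, IsUnit (φ₀ b) := by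
      rintro ⟨b, hb⟩
      obtain ⟨a, rfl⟩ := Ideal.Quotient.mk_surjective b
      refine isUnit_of_residue_ne_zero ε ?_
      change ε (aeval z a) ≠ 0
      rw [residue_aeval ε hz]
      exact fun h => hb ((hq a).2 h)
    refine ⟨IsLocalization.liftAlgHom hu, fun i => ?_⟩
    rw [IsLocalization.liftAlgHom_apply]
    refine (IsLocalization.lift_eq hu _).trans ?_
    change aeval z (X i) = z i
    exact aeval_X z i
  have hI : ∀ a ∈ I, eval v a = 0 := fun a ha => by
    rw [← hq, Ideal.Quotient.eq_zero_iff_mem.2 ha]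
    exact q.zero_mem
  refine ⟨inferInstance, ?_, fun a ha => ?_, hlift, fun φ ψ h => ?_⟩
  · exact hlift (AlgHom.id k k) v (fun _ => rfl) fun a ha => by
      simpa [coe_aeval_eq_eval] using hI a ha
  · rw [hι]
    change algebraMap (MvPolynomial σ k ⧸ I) (Localization.AtPrime q) (Ideal.Quotient.mk I a) = _
    rw [Ideal.Quotient.eq_zero_iff_mem.2 ha, map_zero]
  · exact IsLocalization.algHom_ext q.primeCompl
      (Ideal.Quotient.algHom_ext k (MvPolynomial.algHom_ext h))

/-- The quotient of the localization of a polynomial ring at the ideal of a point. -/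
theorem isLocalRingAt_quotient_localization {I : Ideal (MvPolynomial (Fin 2) k)} {v : Fin 2 → k}
    (hI : ∀ a ∈ I, eval v a = 0) :
    IsLocalRingAt I v (Localization.AtPrime (pointIdeal v) ⧸ I.map
        (algebraMap (MvPolynomial (Fin 2) k) (Localization.AtPrime (pointIdeal v))))
      fun i => Ideal.Quotient.mk _ (algebraMap (MvPolynomial (Fin 2) k) _ (X i)) := by
  set L := Localization.AtPrime (pointIdeal v)
  set K := I.map (algebraMap (MvPolynomial (Fin 2) k) L)
  set y : Fin 2 → L ⧸ K := fun i => Ideal.Quotient.mk K (algebraMap (MvPolynomial (Fin 2) k) L (X i))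
  let ι : MvPolynomial (Fin 2) k →ₐ[k] L ⧸ K :=
    (Ideal.Quotient.mkₐ k K).comp (IsScalarTower.toAlgHom k (MvPolynomial (Fin 2) k) L)
  have hι : aeval y = ι := MvPolynomial.algHom_ext fun i => aeval_X y i
  have hlift : ∀ {P : Type u} [CommRing P] [Algebra k P] [IsLocalRing P] (ε : P →ₐ[k] k)
      (z : Fin 2 → P), (∀ i, ε (z i) = v i) → (∀ a ∈ I, aeval z a = 0) →
      ∃ φ : L ⧸ K →ₐ[k] P, ∀ i, φ (y i) = z i := by
    intro P _ _ _ ε z hz hI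
    have hu : ∀ b : (pointIdeal v).primeCompl, IsUnit ((aeval z : _ →ₐ[k] P) b) := by
      rintro ⟨b, hb⟩
      refine isUnit_of_residue_ne_zero ε ?_
      rw [residue_aeval ε hz]
      exact hb
    let φ₀ : L →ₐ[k] P := IsLocalization.liftAlgHom hu
    have hφ₀ : ∀ a, φ₀ (algebraMap _ L a) = aeval z a := fun a => IsLocalization.lift_eq hu a
    have hK : K ≤ RingHom.ker φ₀ := Ideal.map_le_iff_le_comap.2 fun a ha => by
      rw [Ideal.mem_comap, RingHom.mem_ker, hφ₀, hI a ha]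
    refine ⟨Ideal.Quotient.liftₐ K φ₀ fun a ha => hK ha, fun i => ?_⟩
    change φ₀ (algebraMap _ L (X i)) = z i
    rw [hφ₀, aeval_X]
  have hres : ∃ ε : L ⧸ K →ₐ[k] k, ∀ i, ε (y i) = v i :=
    hlift (AlgHom.id k k) v (fun _ => rfl) fun a ha => by
      simpa [coe_aeval_eq_eval] using hI a ha
  obtain ⟨ε, hε⟩ := hres
  have hnt : Nontrivial (L ⧸ K) := ε.toRingHom.domain_nontrivial
  refine ⟨IsLocalRing.of_surjective' _ Ideal.Quotient.mk_surjective, ⟨ε, hε⟩, fun a ha => ?_, hlift,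
    fun φ ψ h => ?_⟩
  · rw [hι]
    exact Ideal.Quotient.eq_zero_iff_mem.2 (Ideal.mem_map_of_mem _ ha)
  · exact Ideal.Quotient.algHom_ext k
      (IsLocalization.algHom_ext (pointIdeal v).primeCompl (MvPolynomial.algHom_ext h))

/-! ### Local Tjurina algebras and charts -/

theorem pderiv_dehomogenize (i : Fin 3) (j : Fin 2) (f : MvPolynomial (Fin 3) k) :
    pderiv j (dehomogenize i f) = dehomogenize i (pderiv (i.succAbove j) f) := by
  classical
  unfold dehomogenize
  induction f using MvPolynomial.induction_on with
  | C a => simp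
  | add p q hp hq => rw [map_add, map_add, hp, hq, map_add, map_add]
  | mul_X p n hp =>
    rw [map_mul, aeval_X, pderiv_mul, hp, pderiv_mul, map_add, map_mul, map_mul, aeval_X]
    congr 2
    refine Fin.succAboveCases i ?_ (fun m => ?_) n
    · rw [Fin.insertNth_apply_same, pderiv_one, pderiv_X_of_ne (Fin.ne_succAbove i j), map_zero]
    · rw [Fin.insertNth_apply_succAbove]
      rcases eq_or_ne m j with rfl | h
      · simp
      · rw [pderiv_X_of_ne h, pderiv_X_of_ne fun h' => h (Fin.succAbove_right_injective h'),
          map_zero]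

theorem aeval_dehomogenize {P : Type*} [CommRing P] [Algebra k P] (i : Fin 3) (z : Fin 2 → P)
    (f : MvPolynomial (Fin 3) k) :
    aeval z (dehomogenize i f) = aeval (i.insertNth (1 : P) z) f := by
  unfold dehomogenize
  rw [map_aeval]
  congr 2
  funext n
  refine Fin.succAboveCases i ?_ (fun m => ?_) n <;> simp

/-- The local ring of the cone over the singular scheme of `V(f)`, cut by `l = 1`, is the local
Tjurina algebra in the chart `xᵢ = 1`: the isomorphisms are `x ↦ x / l` and `x ↦ x / xᵢ`. -/
theorem nonempty_algEquiv_of_isLocalRingAt {f l : MvPolynomial (Fin 3) k} {d : ℕ}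
    (hd : ((d + 1 : ℕ) : k) ≠ 0) (hf : f.IsHomogeneous (d + 1)) (hl : l.IsHomogeneous 1)
    {v : Fin 3 → k} (hv : eval v l = 1) {i : Fin 3} (hi : v i ≠ 0) {a : Fin 2 → k}
    (ha : ∀ j, a j = v (i.succAbove j) / v i)
    {S₁ S₂ : Type u} [CommRing S₁] [Algebra k S₁] [CommRing S₂] [Algebra k S₂] {x : Fin 3 → S₁}
    {t : Fin 2 → S₂}
    (h₁ : IsLocalRingAt (Ideal.span (Set.range fun i => pderiv i f) ⊔ Ideal.span {l - 1}) v S₁ x)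
    (h₂ : IsLocalRingAt (fullJacobianIdeal (dehomogenize i f)) a S₂ t) :
    Nonempty (S₁ ≃ₐ[k] S₂) := by
  have := h₁.isLocalRing
  have := h₂.isLocalRing
  obtain ⟨ε₁, hε₁⟩ := h₁.exists_residue
  obtain ⟨ε₂, hε₂⟩ := h₂.exists_residue
  have hpd : ∀ n, (pderiv n f).IsHomogeneous d := fun n => hf.pderiv
  have heuler := hf.sum_X_mul_pderiv
  have hx : ∀ n, aeval x (pderiv n f) = 0 := fun n =>
    h₁.aeval_eq_zero _ (Ideal.mem_sup_left (Ideal.subset_span ⟨n, rfl⟩))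
  have hxf : aeval x f = 0 := by
    have h := congrArg (aeval x) heuler
    rw [map_sum, Finset.sum_eq_zero (fun n _ => by rw [map_mul, hx, mul_zero]), map_nsmul,
      ← Nat.cast_smul_eq_nsmul k] at h
    exact ((smul_eq_zero_iff_right hd).1 h.symm)
  have hxl : aeval x l = 1 := by
    have h := h₁.aeval_eq_zero _ (Ideal.mem_sup_right (Ideal.mem_span_singleton_self (l - 1)))
    rwa [map_sub, map_one, sub_eq_zero] at h
  -- The map `S₂ → S₁`, dividing by `xᵢ`.
  obtain ⟨u, hu⟩ := (isUnit_of_residue_ne_zero ε₁ (s := x i) (by rwa [hε₁])).exists_left_inv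
  have hεu : ε₁ u * v i = 1 := by rw [← hε₁, ← map_mul, hu, map_one]
  have hins : (i.insertNth (1 : S₁) fun j => u * x (i.succAbove j)) = fun n => u * x n := by
    funext n
    refine Fin.succAboveCases i ?_ (fun m => ?_) n
    · rw [Fin.insertNth_apply_same, hu]
    · rw [Fin.insertNth_apply_succAbove]
  obtain ⟨φ, hφ⟩ := h₂.exists_lift ε₁ (fun j => u * x (i.succAbove j)) (fun j => by
      rw [map_mul, hε₁, ha, eq_div_iff hi, mul_right_comm, hεu, one_mul]) (by
    have hz : ∀ {g : MvPolynomial (Fin 3) k} {m : ℕ}, g.IsHomogeneous m → aeval x g = 0 →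
        aeval (fun j => u * x (i.succAbove j)) (dehomogenize i g) = 0 := fun hg hg0 => by
      rw [aeval_dehomogenize, hins, aeval_const_mul hg, hg0, mul_zero]
    change fullJacobianIdeal (dehomogenize i f) ≤
      RingHom.ker (aeval (R := k) fun j => u * x (i.succAbove j))
    rw [fullJacobianIdeal, Ideal.span_le, pderiv_dehomogenize, pderiv_dehomogenize]
    rintro _ (rfl | rfl | rfl)
    exacts [hz hf hxf, hz (hpd _) (hx _), hz (hpd _) (hx _)])
  -- The map `S₁ → S₂`, dividing by `l`.
  let T : Fin 3 → S₂ := i.insertNth (1 : S₂) t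
  have hTi : T i = 1 := Fin.insertNth_apply_same (α := fun _ => S₂) i 1 t
  have hTj : ∀ j, T (i.succAbove j) = t j := fun j =>
    Fin.insertNth_apply_succAbove (α := fun _ => S₂) i 1 t j
  have hεT : ∀ n, ε₂ (T n) = (v i)⁻¹ * v n := by
    intro n
    refine Fin.succAboveCases i ?_ (fun m => ?_) n
    · rw [hTi, map_one, inv_mul_cancel₀ hi]
    · rw [hTj, hε₂, ha, div_eq_inv_mul]
  have hTl : ε₂ (aeval T l) = (v i)⁻¹ := by
    rw [residue_aeval ε₂ hεT, eval_const_mul hl, hv, mul_one, pow_one]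
  obtain ⟨m, hm⟩ := (isUnit_of_residue_ne_zero ε₂ (s := aeval T l)
    (by rw [hTl]; exact inv_ne_zero hi)).exists_left_inv
  have hεm : ε₂ m = v i := by
    have h := congrArg ε₂ hm
    rw [map_mul, hTl, map_one] at h
    exact (mul_inv_eq_one₀ hi).1 h
  have hTF : ∀ g : MvPolynomial (Fin 3) k, aeval T g = aeval t (dehomogenize i g) :=
    fun g => (aeval_dehomogenize i t g).symm
  have hTf : aeval T f = 0 := by
    rw [hTF]
    exact h₂.aeval_eq_zero _ (Ideal.subset_span (by simp))
  have hTs : ∀ j, aeval T (pderiv (i.succAbove j) f) = 0 := by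
    intro j
    rw [hTF, ← pderiv_dehomogenize]
    refine h₂.aeval_eq_zero _ (Ideal.subset_span ?_)
    fin_cases j <;> simp
  -- The Tjurina ideal omits the derivative with respect to `xᵢ`; Euler's identity supplies it.
  have hT : ∀ n, aeval T (pderiv n f) = 0 := by
    intro n
    refine Fin.succAboveCases i ?_ hTs n
    have h := congrArg (aeval T) heuler
    rw [Fin.sum_univ_succAbove _ i, map_add, map_sum, Finset.sum_eq_zero (fun j _ => by
      rw [map_mul, hTs, mul_zero]), map_mul, aeval_X, hTi, one_mul, add_zero, map_nsmul, hTf,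
      smul_zero] at h
    exact h
  have hmTl : aeval (fun n => m * T n) l = 1 := by rw [aeval_const_mul hl, pow_one, hm]
  obtain ⟨ψ, hψ⟩ := h₁.exists_lift ε₂ (fun n => m * T n) (fun n => by
      rw [map_mul, hεT, hεm, mul_inv_cancel_left₀ hi]) (by
    change _ ≤ RingHom.ker (aeval (R := k) fun n => m * T n)
    refine sup_le (Ideal.span_le.2 ?_) (Ideal.span_le.2 ?_)
    · rintro _ ⟨n, rfl⟩
      rw [SetLike.mem_coe, RingHom.mem_ker, aeval_const_mul (hpd n), hT, mul_zero]
    · rintro _ rfl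
      rw [SetLike.mem_coe, RingHom.mem_ker, map_sub, map_one, hmTl, sub_self])
  have hφT : ∀ n, φ (T n) = u * x n := by
    intro n
    refine Fin.succAboveCases i ?_ (fun j => ?_) n
    · rw [hTi, map_one, hu]
    · rw [hTj, hφ]
  have hφm : φ m = x i := by
    have h := congrArg φ hm
    rw [map_mul, map_aeval, map_one] at h
    simp_rw [hφT] at h
    rw [aeval_const_mul hl, hxl, pow_one, mul_one] at h
    calc φ m = φ m * (u * x i) := by rw [hu, mul_one]
      _ = (φ m * u) * x i := by ring
      _ = x i := by rw [h, one_mul]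
  have hψu : ψ u * m = 1 := by
    have h := congrArg ψ hu
    rwa [map_mul, hψ, hTi, mul_one, map_one] at h
  refine ⟨AlgEquiv.ofAlgHom ψ φ (h₂.hom_ext _ _ fun j => ?_) (h₁.hom_ext _ _ fun n => ?_)⟩
  · rw [AlgHom.comp_apply, hφ, map_mul, hψ, hTj, ← mul_assoc, hψu, one_mul, AlgHom.id_apply]
  · rw [AlgHom.comp_apply, hψ, map_mul, hφT, hφm, AlgHom.id_apply, ← mul_assoc, mul_comm (x i), hu,
      one_mul]

end LocalRing

section Assembly

variable {k : Type u} [Field k]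

/-! ### The total Tjurina number as a value of the Hilbert function -/

theorem eval_smul_of_isHomogeneous {a : MvPolynomial (Fin 3) k} {n : ℕ} (ha : a.IsHomogeneous n)
    (c : k) (v : Fin 3 → k) : eval (c • v) a = c ^ n * eval v a :=
  eval_const_mul ha c v

/-- By Euler's identity, the vanishing of the form at a singular point is implied by that of its
derivatives. -/
theorem singularPoints_eq_projZeros {f : MvPolynomial (Fin 3) k} {d : ℕ}
    (hd : ((d + 1 : ℕ) : k) ≠ 0) (hf : f.IsHomogeneous (d + 1)) :
    singularPoints f = projZeros (Ideal.span (Set.range fun i => pderiv i f)) := by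
  ext p
  constructor
  · rintro ⟨-, hp⟩ a ha
    have hle : Ideal.span (Set.range fun i => pderiv i f) ≤ RingHom.ker (eval p.rep) :=
      Ideal.span_le.2 (by rintro _ ⟨i, rfl⟩; exact hp i)
    exact hle ha
  · intro hp
    have hp' : ∀ i, eval p.rep (pderiv i f) = 0 := fun i => hp _ (Ideal.subset_span ⟨i, rfl⟩)
    refine ⟨?_, hp'⟩
    have h := congrArg (eval p.rep) hf.sum_X_mul_pderiv
    rw [map_sum, Finset.sum_eq_zero (fun n _ => by rw [map_mul, hp', mul_zero]), map_nsmul,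
      nsmul_eq_mul] at h
    exact (mul_eq_zero.1 h.symm).resolve_left hd

/-- The representative of the point `p` on the affine plane `l = 1`, for a linear form `l` that does
not vanish at `p`. -/
noncomputable def normalizedRep (l : MvPolynomial (Fin 3) k) (p : ℙ k (Fin 3 → k)) : Fin 3 → k :=
  (eval p.rep l)⁻¹ • p.rep

theorem eval_normalizedRep {l : MvPolynomial (Fin 3) k} (hl : l.IsHomogeneous 1)
    {p : ℙ k (Fin 3 → k)} (hp : eval p.rep l ≠ 0) : eval (normalizedRep l p) l = 1 := by
  rw [normalizedRep, eval_smul_of_isHomogeneous hl, pow_one, inv_mul_cancel₀ hp]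

theorem normalizedRep_mk {l : MvPolynomial (Fin 3) k} (hl : l.IsHomogeneous 1) {v : Fin 3 → k}
    (hv : v ≠ 0) (hlv : eval v l = 1) : normalizedRep l (Projectivization.mk k v hv) = v := by
  obtain ⟨c, hc⟩ := Projectivization.exists_smul_eq_mk_rep k v hv
  rw [normalizedRep, ← hc, Units.smul_def, eval_smul_of_isHomogeneous hl, hlv, pow_one, mul_one,
    smul_smul, inv_mul_cancel₀ c.ne_zero, one_smul]

theorem eq_of_normalizedRep_eq {l : MvPolynomial (Fin 3) k} {p q : ℙ k (Fin 3 → k)}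
    (hp : eval p.rep l ≠ 0) (h : normalizedRep l p = normalizedRep l q) : p = q := by
  rw [← p.mk_rep, ← q.mk_rep, Projectivization.mk_eq_mk_iff']
  refine ⟨eval p.rep l * (eval q.rep l)⁻¹, ?_⟩
  have h' := congrArg (fun v => eval p.rep l • v) h
  simp only [normalizedRep, smul_smul, mul_inv_cancel₀ hp, one_smul] at h'
  exact h'.symm

theorem mk_mem_projZeros {w : Fin 3 → MvPolynomial (Fin 3) k} {d : ℕ}
    (hw : ∀ i, (w i).IsHomogeneous d) {v : Fin 3 → k} (hv : v ≠ 0) (h : ∀ i, eval v (w i) = 0) :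
    Projectivization.mk k v hv ∈ projZeros (Ideal.span (Set.range w)) := by
  obtain ⟨c, hc⟩ := Projectivization.exists_smul_eq_mk_rep k v hv
  have hle : Ideal.span (Set.range w) ≤ RingHom.ker (eval (Projectivization.mk k v hv).rep) := by
    refine Ideal.span_le.2 ?_
    rintro _ ⟨i, rfl⟩
    rw [SetLike.mem_coe, RingHom.mem_ker, ← hc, Units.smul_def,
      eval_smul_of_isHomogeneous (hw i), h i, mul_zero]
  exact fun a ha => hle ha

/-- A finite algebra `R/(J + (l - 1))` has one prime for each zero of `J` in the projective plane,
provided that the linear form `l` vanishes at none of these zeros. -/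
theorem exists_equiv_primeSpectrum [IsAlgClosed k] {w : Fin 3 → MvPolynomial (Fin 3) k} {d : ℕ}
    (hw : ∀ i, (w i).IsHomogeneous d) {l : MvPolynomial (Fin 3) k} (hl : l.IsHomogeneous 1)
    (hlw : ∀ p ∈ projZeros (Ideal.span (Set.range w)), eval p.rep l ≠ 0)
    [Module.Finite k (MvPolynomial (Fin 3) k ⧸ (Ideal.span (Set.range w) ⊔ Ideal.span {l - 1}))] :
    ∃ e : projZeros (Ideal.span (Set.range w)) ≃
        PrimeSpectrum (MvPolynomial (Fin 3) k ⧸ (Ideal.span (Set.range w) ⊔ Ideal.span {l - 1})),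
      ∀ p a, Ideal.Quotient.mk _ a ∈ (e p).asIdeal ↔ eval (normalizedRep l p.1) a = 0 := by
  set J := Ideal.span (Set.range w)
  set I := J ⊔ Ideal.span {l - 1}
  have hI : ∀ p : projZeros J, ∀ a ∈ I, eval (normalizedRep l p.1) a = 0 := by
    intro p
    change I ≤ RingHom.ker (eval (normalizedRep l p.1))
    refine sup_le (Ideal.span_le.2 ?_) (Ideal.span_le.2 ?_)
    · rintro _ ⟨i, rfl⟩
      rw [SetLike.mem_coe, RingHom.mem_ker, normalizedRep, eval_smul_of_isHomogeneous (hw i),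
        p.2 _ (Ideal.subset_span ⟨i, rfl⟩), mul_zero]
    · rintro _ rfl
      rw [SetLike.mem_coe, RingHom.mem_ker, map_sub, map_one, eval_normalizedRep hl (hlw _ p.2),
        sub_self]
  let P : projZeros J → PrimeSpectrum (MvPolynomial (Fin 3) k ⧸ I) := fun p =>
    ⟨RingHom.ker (Ideal.Quotient.lift I (eval (normalizedRep l p.1)) (hI p)), RingHom.ker_isPrime _⟩
  have hP : ∀ p a, Ideal.Quotient.mk I a ∈ (P p).asIdeal ↔ eval (normalizedRep l p.1) a = 0 :=
    fun p a => by rw [RingHom.mem_ker, Ideal.Quotient.lift_mk]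
  refine ⟨Equiv.ofBijective P ⟨fun p q hpq => ?_, fun q => ?_⟩, hP⟩
  · refine Subtype.ext (eq_of_normalizedRep_eq (hlw _ p.2) (funext fun i => ?_))
    have h1 := (hP p (X i - C (normalizedRep l p.1 i))).2 (by simp)
    rw [hpq, hP] at h1
    rw [map_sub, eval_X, eval_C, sub_eq_zero] at h1
    exact h1.symm
  · have : IsArtinianRing (MvPolynomial (Fin 3) k ⧸ I) := IsArtinianRing.of_finite k _
    have hmax : (q.asIdeal.comap (Ideal.Quotient.mk I)).IsMaximal :=
      Ideal.comap_isMaximal_of_surjective _ Ideal.Quotient.mk_surjective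
    obtain ⟨v, hv⟩ := eq_vanishingIdeal_singleton_of_isMaximal k hmax
    have hqv : ∀ a, Ideal.Quotient.mk I a ∈ q.asIdeal ↔ eval v a = 0 := fun a => by
      rw [← Ideal.mem_comap, hv, mem_vanishingIdeal_singleton_iff, ← coe_aeval_eq_eval,
        RingHom.coe_coe]
    have hvI : ∀ a ∈ I, eval v a = 0 := fun a ha => by
      rw [← hqv, Ideal.Quotient.eq_zero_iff_mem.2 ha]
      exact q.asIdeal.zero_mem
    have hvl : eval v l = 1 := by
      have h := hvI _ (Ideal.mem_sup_right (Ideal.mem_span_singleton_self (l - 1)))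
      rwa [map_sub, map_one, sub_eq_zero] at h
    have hv0 : v ≠ 0 := by
      rintro rfl
      have h := eval_smul_of_isHomogeneous hl 0 (0 : Fin 3 → k)
      rw [zero_smul, hvl] at h
      simp at h
    refine ⟨⟨_, mk_mem_projZeros hw hv0 fun i =>
      hvI _ (Ideal.mem_sup_left (Ideal.subset_span ⟨i, rfl⟩))⟩, ?_⟩
    refine PrimeSpectrum.ext (Ideal.ext fun b => ?_)
    obtain ⟨a, rfl⟩ := Ideal.Quotient.mk_surjective b
    rw [hP, hqv, normalizedRep_mk hl hv0 hvl]

/-- If the Hilbert function of `R/J` is bounded in large degrees, where `J` is generated by the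
partial derivatives of `f`, then its eventual value is the total Tjurina number of `V(f)`. -/
theorem totalTjurina_eq_hilbertFn [IsAlgClosed k] {f : MvPolynomial (Fin 3) k} {d : ℕ}
    (hd : ((d + 1 : ℕ) : k) ≠ 0) (hf : f.IsHomogeneous (d + 1)) {N b : ℕ}
    (hb : ∀ n, N ≤ n → hilbertFn (Ideal.span (Set.range fun i => pderiv i f)) n ≤ b) :
    (singularPoints f).Finite ∧
    (∀ p ∈ singularPoints f, Module.Finite k (LocalTjurinaAlgebra f p)) ∧
    ∃ M, ∀ n, M ≤ n →
      totalTjurina f = hilbertFn (Ideal.span (Set.range fun i => pderiv i f)) n := by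
  have hw : ∀ i, (pderiv i f).IsHomogeneous d := fun i => hf.pderiv
  have hsing := singularPoints_eq_projZeros hd hf
  set J := Ideal.span (Set.range fun i => pderiv i f)
  have hfin : (projZeros J).Finite := projZeros_finite hb
  obtain ⟨c, hc⟩ := exists_linForm_ne_zero hfin
  have hl := linForm_isHomogeneous c
  set l := linForm c
  obtain ⟨N', hN'⟩ := exists_forall_eq_add_mul hw hl fun v hv hvl => by
    by_contra hv0
    have h := hc _ (mk_mem_projZeros hw hv0 hv)
    obtain ⟨c, hc⟩ := Projectivization.exists_smul_eq_mk_rep k v hv0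
    rw [← hc, Units.smul_def, eval_smul_of_isHomogeneous hl, hvl, mul_zero] at h
    exact h rfl
  obtain ⟨hB, M, hM⟩ := finrank_quotient_eq_hilbertFn hw hl hN'
  obtain ⟨e, he⟩ := exists_equiv_primeSpectrum hw hl hc
  set B := MvPolynomial (Fin 3) k ⧸ (J ⊔ Ideal.span {l - 1})
  have hart : IsArtinianRing B := IsArtinianRing.of_finite k _
  have hequiv : ∀ p : projZeros J,
      Nonempty (Localization.AtPrime (e p).asIdeal ≃ₐ[k] LocalTjurinaAlgebra f p.1) := by
    intro p
    have hp0 : p.1.rep (chart p.1) ≠ 0 := (exists_rep_ne_zero p.1).choose_spec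
    have hpl := hc _ p.2
    have hps : p.1 ∈ singularPoints f := by rw [hsing]; exact p.2
    have hi : normalizedRep l p.1 (chart p.1) ≠ 0 := mul_ne_zero (inv_ne_zero hpl) hp0
    have ha : ∀ j, affineCoords p.1 j =
        normalizedRep l p.1 ((chart p.1).succAbove j) / normalizedRep l p.1 (chart p.1) :=
      fun j => (mul_div_mul_left _ _ (inv_ne_zero hpl)).symm
    have hzero : ∀ {g : MvPolynomial (Fin 3) k} {m : ℕ}, g.IsHomogeneous m → eval p.1.rep g = 0 →
        eval (affineCoords p.1) (dehomogenize (chart p.1) g) = 0 := by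
      intro g m hg hg0
      have h := aeval_dehomogenize (chart p.1) (affineCoords p.1) g
      have hev : ∀ {σ : Type} (v : σ → k) (a : MvPolynomial σ k), aeval v a = eval v a :=
        fun v a => by rw [← coe_aeval_eq_eval, RingHom.coe_coe]
      have hins : (chart p.1).insertNth (1 : k) (affineCoords p.1) =
          (p.1.rep (chart p.1))⁻¹ • p.1.rep := by
        funext n
        refine Fin.succAboveCases (chart p.1) ?_ (fun m => ?_) n
        · simp [inv_mul_cancel₀ hp0]
        · simp [affineCoords, div_eq_inv_mul]
      rw [← hev, h, hins, hev, eval_smul_of_isHomogeneous hg, hg0, mul_zero]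
    have hI : ∀ a ∈ fullJacobianIdeal (dehomogenize (chart p.1) f),
        eval (affineCoords p.1) a = 0 := by
      change fullJacobianIdeal (dehomogenize (chart p.1) f) ≤ RingHom.ker (eval (affineCoords p.1))
      rw [fullJacobianIdeal, Ideal.span_le, pderiv_dehomogenize, pderiv_dehomogenize]
      rintro _ (rfl | rfl | rfl)
      exacts [hzero hf hps.1, hzero (hw _) (hps.2 _), hzero (hw _) (hps.2 _)]
    exact nonempty_algEquiv_of_isLocalRingAt hd hf hl (eval_normalizedRep hl hpl) hi ha
      (isLocalRingAt_localization_quotient _ (he p)) (isLocalRingAt_quotient_localization hI)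
  refine ⟨hsing ▸ hfin, fun p hp => ?_, M, fun n hn => ?_⟩
  · rw [hsing] at hp
    obtain ⟨E⟩ := hequiv ⟨p, hp⟩
    have : Module.Finite k (Localization.AtPrime (e ⟨p, hp⟩).asIdeal) :=
      Module.Finite.of_surjective (Algebra.algHom k B _).toLinearMap
        (IsArtinianRing.localization_surjective (e ⟨p, hp⟩).asIdeal.primeCompl _)
    exact Module.Finite.equiv E.toLinearEquiv
  · have : Fintype (PrimeSpectrum B) := Fintype.ofFinite _
    rw [← hM n hn, IsArtinianRing.finrank_eq_sum_primeSpectrum B k, totalTjurina, hsing,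
      ← finsum_subtype_eq_finsum_cond, ← finsum_eq_sum_of_fintype, ← finsum_comp_equiv e]
    refine finsum_congr fun p => ?_
    obtain ⟨E⟩ := hequiv p
    exact E.toLinearEquiv.finrank_eq.symm

end Assembly

end PlaneCurve

/-! ### The bounds for the total Tjurina number -/

theorem mainTheorem6 {k : Type*} [Field k] [IsAlgClosed k] (d : ℕ) (hd : ((d + 1 : ℕ) : k) ≠ 0)
    (f : MvPolynomial (Fin 3) k) (hf0 : f ≠ 0) (hf : f.IsHomogeneous (d + 1))
    (hred : (Ideal.span {f}).IsRadical) (hsing : (PlaneCurve.singularPoints f).Nonempty)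
    (e : ℕ) (he : e = PlaneCurve.indeg (PlaneCurve.syz f)) :
    (PlaneCurve.singularPoints f).Finite ∧
    (∀ p ∈ PlaneCurve.singularPoints f,
      Module.Finite k (PlaneCurve.LocalTjurinaAlgebra f p)) ∧
    (d : ℤ) * ((d : ℤ) - (e : ℤ)) ≤ (PlaneCurve.totalTjurina f : ℤ) ∧
    (PlaneCurve.totalTjurina f : ℤ) ≤ (d : ℤ) ^ 2 + (e : ℤ) * ((e : ℤ) - (d : ℤ)) := by
  have hsq : Squarefree f :=
    IsRadical.squarefree hf0 (isRadical_iff_span_singleton.2 hred)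
  have hw : ∀ i, (pderiv i f).IsHomogeneous d := fun i => hf.pderiv
  have hwp := PlaneCurve.noCommonPrime_pderiv hd hf hsq
  have hw0 : ∃ i, pderiv i f ≠ 0 := by
    obtain ⟨i, hi⟩ := hwp (X 0) X_prime
    exact ⟨i, fun h0 => hi (by simp only [h0, dvd_zero])⟩
  obtain ⟨g, hg, hg0, hgh⟩ := (PlaneCurve.isLeast_indeg_syz hf).1
  have hgp := PlaneCurve.noCommonPrime_of_minimal_syz hf hg hg0 hgh
  rw [← he] at hgh
  have hbounds := PlaneCurve.hilbertFn_bounds hw hgh (PlaneCurve.mem_syz.1 hg) hwp hw0 hgp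
    (Function.ne_iff.1 hg0)
  obtain ⟨hfin, hmod, M, hM⟩ := PlaneCurve.totalTjurina_eq_hilbertFn hd hf (N := d + e + d)
    (b := ((d : ℤ) ^ 2 + (e : ℤ) * ((e : ℤ) - d)).toNat) fun n hn => by
      obtain ⟨m, rfl⟩ := Nat.exists_eq_add_of_le' hn
      have := (hbounds m).2
      rw [show m + d + e + d = m + (d + e + d) by ring] at this
      omega
  refine ⟨hfin, hmod, ?_⟩
  rw [hM (M + d + e + d) (by omega)]
  exact hbounds M
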